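/- **Theorem 1 (BvM theorem for a covariance matrix).** For each $n$ let $p=p_n\ge 1$, and let $Y_1,\dots,Y_n$ be i.i.d. random vectors in $\mathbb R^{p_n}$ (under a probability measure $\mathbb P_{0n}$, and with $p_n$ and the law of $Y_1$ allowed to change with $n$) with mean zero and covariance matrix $\Sigma_{0}=\Sigma_{0n}$. Assume that there are constants $k_\sigma\in(0,1]$ and $\sigma_0>0$, not depending on $n$, such that all eigenvalues of $\Sigma_{0n}$ lie in $[k_\sigma,1/k_\sigma]$ and $\|\Sigma_{0n}^{-1/2}Y_1\|_{\psi_2}\le\sigma_0$, where $\|X\|_{\psi_2}=\sup_{\|u\|=1}\sup_{q\ge1}q^{-1/2}(E|u^TX|^q)^{1/q}$. Assume also $p_n^5/n\to0$. Let $S=\frac1n\sum_{i=1}^nY_iY_i^T$, write $\|\cdot\|$ for the spectral norm, and write $dT$ for Lebesgue measure on symmetric $p\times p$ matrices in the coordinates $\mathrm{vech}(T)=(T_{ij})_{j\le i}$. The working model is $Y_i\sim N_p(0,\Sigma)$, with log-likelihood $$l_n(\Sigma)=-\tfrac{np}{2}\log(2\pi)-\tfrac n2\log\det\Sigma-\tfrac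 n2\mathrm{tr}(\Sigma^{-1}S),$$ and $\Sigma$ has a prior with probability density $\pi_n$ on the positive definite $p\times p$ matrices; $\Pi_n(\cdot\mid Y^n)$ denotes the posterior distribution of $\Sigma$. Put $B_n=\{T: S+T/\sqrt n\text{ is symmetric positive definite}\}$, and let $$\pi_n(T\mid Y^n)=\frac{M_n(T)\,\pi_n(S+T/\sqrt n)}{\int_{B_n}M_n(W)\,\pi_n(S+W/\sqrt n)\,dW},\qquad M_n(T)=\exp\{l_n(S+T/\sqrt n)-l_n(S)\},\quad T\in B_n,$$ be the posterior density of $T=\sqrt n(\Sigma-S)$. Put $\epsilon_n=\sqrt{p_n/n}$ and assume: (i) (the posterior contracts at the rate $\epsilon_n$) for every sequence $M_n\to\infty$, $\Pi_n(\|\Sigma-\Sigma_{0n}\|>M_n\epsilon_n\mid Y^n)\to0$ in $\mathbb P_{0n}$-probability; (ii) (the prior is flat around $S$) for every constant $M>0$, $$\sup\left\{\left|\frac{\pi_n(S+T/\sqrt n)}{\pi_n(S)}-1\right| : T\in B_n,\ \|T\|\le\sqrt n\,M\epsilon_n\right\}\to0\quad\text{in }\mathbb P_{0n}\text{-probability.}$$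 Let $B_p$ be the $p^2\times\frac{p(p+1)}2$ matrix for which the row of $B_p^T$ with index $(i,j)$, $j\le i$, is $\frac12(e_j^T\otimes e_i^T+e_i^T\otimes e_j^T)$, so that $\mathrm{vech}(A)=B_p^T\mathrm{vec}(A)$ for symmetric $A$, and let $\phi(\cdot\,;S)$ be the density of the symmetric matrix-normal distribution $\mathcal{SMN}_{p\times p}(0,\,2B_p^T(S\otimes S)B_p)$, i.e. of the law of a symmetric random matrix $X$ with $\mathrm{vech}(X)\sim N_{p(p+1)/2}(0,\,2B_p^T(S\otimes S)B_p)$. Then $$\int_{B_n}\left|\pi_n(T\mid Y^n)-\phi(T;S)\right|dT\;\longrightarrow\;0\quad\text{in }\mathbb P_{0n}\text{-probability as }n\to\infty.$$ -/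

import Mathlib

open MeasureTheory ProbabilityTheory Filter Topology
open scoped ENNReal Matrix MatrixOrder Kronecker

noncomputable section

namespace BvM

/-! ### Symmetric matrices, half-vectorisation, and the matrix `B_p` -/

/-- Positions `(i, j)` with `j ≤ i`: on and below the diagonal. There are `p (p + 1) / 2` of them. -/
abbrev VechIdx (p : ℕ) : Type := {ij : Fin p × Fin p // ij.2 ≤ ij.1}

/-- `vech A`: the entries of `A` on and below the diagonal. -/
def vech {p : ℕ} (A : Matrix (Fin p) (Fin p) ℝ) : VechIdx p → ℝ :=
  fun k => A k.1.1 k.1.2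

/-- The symmetric matrix with given half-vectorisation. Integrals `dT` over symmetric matrices are
Lebesgue integrals in the coordinates `x : VechIdx p → ℝ`, with `T = unvech x`. -/
def unvech {p : ℕ} (x : VechIdx p → ℝ) : Matrix (Fin p) (Fin p) ℝ :=
  fun i j => if h : j ≤ i then x ⟨(i, j), h⟩ else x ⟨(j, i), (not_le.mp h).le⟩

/-- The `p² × p(p+1)/2` matrix `B_p`; the row of `B_pᵀ` indexed by `(i, j)`, `j ≤ i`, is
`(e_jᵀ ⊗ e_iᵀ + e_iᵀ ⊗ e_jᵀ) / 2`. -/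
def Bmat (p : ℕ) : Matrix (Fin p × Fin p) (VechIdx p) ℝ :=
  fun k l => ((if k = (l.1.2, l.1.1) then 1 else 0) + (if k = (l.1.1, l.1.2) then 1 else 0)) / 2

/-- `B_pᵀ` is an elimination matrix: `vech A = B_pᵀ vec A` for symmetric `A`. -/
theorem Bmat_transpose_mulVec_vec {p : ℕ} (A : Matrix (Fin p) (Fin p) ℝ) (hA : A.IsSymm) :
    (Bmat p)ᵀ *ᵥ A.vec = vech A := by
  funext l
  have h : A l.1.2 l.1.1 = A l.1.1 l.1.2 := hA.apply _ _
  simp [Matrix.mulVec, dotProduct, Bmat, vech, add_div, add_mul, ite_div,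
    Finset.sum_add_distrib, Matrix.vec, h]
  ring

/-- Spectral norm of a matrix. -/
def specNorm {p : ℕ} (A : Matrix (Fin p) (Fin p) ℝ) : ℝ :=
  ‖Matrix.toEuclideanCLM (n := Fin p) (𝕜 := ℝ) A‖

/-- Density of the multivariate normal distribution `N(m, V)` with respect to Lebesgue measure. -/
def normalPdf {ι : Type*} [Fintype ι] [DecidableEq ι] (m : ι → ℝ) (V : Matrix ι ι ℝ)
    (x : ι → ℝ) : ℝ :=
  Real.exp (-((x - m) ⬝ᵥ (V⁻¹ *ᵥ (x - m))) / 2) /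
    Real.sqrt ((2 * Real.pi) ^ Fintype.card ι * V.det)

/-- Density at the symmetric matrix `X` of the symmetric matrix-normal distribution `SMN(M, V)`,
that is, of the law given by `vech X ∼ N(vech M, V)`. -/
def smnPdf {p : ℕ} (M : Matrix (Fin p) (Fin p) ℝ) (V : Matrix (VechIdx p) (VechIdx p) ℝ)
    (X : Matrix (Fin p) (Fin p) ℝ) : ℝ :=
  normalPdf (vech M) V (vech X)

/-- `φ(T; S)`: the density of `SMN(0, 2 B_pᵀ (S ⊗ S) B_p)`. -/
def phi {p : ℕ} (S T : Matrix (Fin p) (Fin p) ℝ) : ℝ :=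
  smnPdf 0 ((2 : ℝ) • ((Bmat p)ᵀ * (S ⊗ₖ S) * Bmat p)) T

/-! ### The working Gaussian model, prior and posterior -/

/-- `S = n⁻¹ ∑ Yᵢ Yᵢᵀ`. -/
def sampleCov {n p : ℕ} (y : Fin n → Fin p → ℝ) : Matrix (Fin p) (Fin p) ℝ :=
  (1 / (n : ℝ)) • ∑ i, Matrix.vecMulVec (y i) (y i)

/-- Gaussian log-likelihood `l_n(Σ)`, for a sample of size `n` with sample covariance `S`. -/
def logLik {p : ℕ} (n : ℕ) (S Sig : Matrix (Fin p) (Fin p) ℝ) : ℝ :=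
  -((n : ℝ) * p / 2) * Real.log (2 * Real.pi) - (n : ℝ) / 2 * Real.log Sig.det
    - (n : ℝ) / 2 * (Sig⁻¹ * S).trace

/-- The positive definite cone, in half-vectorised coordinates. -/
def posDefVech (p : ℕ) : Set (VechIdx p → ℝ) := {x | (unvech x).PosDef}

/-- `f` is a probability density on the cone of positive definite `p × p` matrices (extended
by zero). -/
structure IsPriorDensity {p : ℕ} (f : Matrix (Fin p) (Fin p) ℝ → ℝ) : Prop where
  nonneg : ∀ Sig, 0 ≤ f Sig
  eq_zero : ∀ Sig, ¬ Sig.PosDef → f Sig = 0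
  measurable : Measurable fun x : VechIdx p → ℝ => f (unvech x)
  lintegral_eq_one : ∫⁻ x : VechIdx p → ℝ, ENNReal.ofReal (f (unvech x)) = 1

/-- Likelihood times prior, as a measure on half-vectorised positive definite matrices. -/
def unnormPosterior {p : ℕ} (f : Matrix (Fin p) (Fin p) ℝ → ℝ) (n : ℕ)
    (S : Matrix (Fin p) (Fin p) ℝ) : Measure (VechIdx p → ℝ) :=
  (volume.restrict (posDefVech p)).withDensity fun x =>
    ENNReal.ofReal (Real.exp (logLik n S (unvech x)) * f (unvech x))

/-- The posterior distribution of (the half-vectorisation of) `Σ`. -/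
def posterior {p : ℕ} (f : Matrix (Fin p) (Fin p) ℝ → ℝ) (n : ℕ)
    (S : Matrix (Fin p) (Fin p) ℝ) : Measure (VechIdx p → ℝ) :=
  (unnormPosterior f n S Set.univ)⁻¹ • unnormPosterior f n S

/-- `B_{1n}`: the matrices `T` with `S + T / √n` positive definite. -/
def setB {p : ℕ} (n : ℕ) (S : Matrix (Fin p) (Fin p) ℝ) : Set (Matrix (Fin p) (Fin p) ℝ) :=
  {T | (S + (1 / Real.sqrt n) • T).PosDef}

/-- `B_{1n}` in half-vectorised coordinates. -/
def setBVech {p : ℕ} (n : ℕ) (S : Matrix (Fin p) (Fin p) ℝ) : Set (VechIdx p → ℝ) :=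
  {x | unvech x ∈ setB n S}

open Classical in
/-- Likelihood ratio `M_{1n}(T) = exp (l_n(S + T / √n) - l_n(S))`, zero off `B_{1n}`. -/
def likRatio {p : ℕ} (n : ℕ) (S T : Matrix (Fin p) (Fin p) ℝ) : ℝ :=
  if T ∈ setB n S then
    Real.exp (logLik n S (S + (1 / Real.sqrt n) • T) - logLik n S S)
  else 0

/-- Posterior density `π_{1n}(T | Yⁿ)` of `T = √n (Σ - S)`. -/
def posteriorPdf {p : ℕ} (f : Matrix (Fin p) (Fin p) ℝ → ℝ) (n : ℕ)
    (S T : Matrix (Fin p) (Fin p) ℝ) : ℝ :=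
  likRatio n S T * f (S + (1 / Real.sqrt n) • T) /
    ∫ w in setBVech n S, likRatio n S (unvech w) * f (S + (1 / Real.sqrt n) • unvech w)

/-- `∫_{B_{1n}} |π_{1n}(T | Yⁿ) - φ(T; S)| dT`. -/
def l1Dist {p : ℕ} (f : Matrix (Fin p) (Fin p) ℝ → ℝ) (n : ℕ)
    (S : Matrix (Fin p) (Fin p) ℝ) : ℝ≥0∞ :=
  ∫⁻ x in setBVech n S, ENNReal.ofReal |posteriorPdf f n S (unvech x) - phi S (unvech x)|

/-- `ρ(r) = sup |f(S + T/√n) / f(S) - 1|` over `T ∈ B_{1n}` with `‖T‖ ≤ √n r`. (If `f S = 0` the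
supremum is at least one, by the convention for division by zero, when `S` is positive definite.) -/
def flatness {p : ℕ} (f : Matrix (Fin p) (Fin p) ℝ → ℝ) (n : ℕ)
    (S : Matrix (Fin p) (Fin p) ℝ) (r : ℝ) : ℝ≥0∞ :=
  ⨆ T ∈ {T | T ∈ setB n S ∧ specNorm T ≤ Real.sqrt n * r},
    ENNReal.ofReal |f (S + (1 / Real.sqrt n) • T) / f S - 1|

/-! ### Stochastic convergence, and the true data-generating mechanism -/

/-- `Z n → 0` in probability under `P n` (each `Z n` on its own probability space). -/
def TendstoZeroInProb {Ω : ℕ → Type*} [∀ n, MeasurableSpace (Ω n)] (P : ∀ n, Measure (Ω n))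
    (Z : ∀ n, Ω n → ℝ≥0∞) : Prop :=
  ∀ ε : ℝ≥0∞, 0 < ε → Tendsto (fun n => P n {ω | ε ≤ Z n ω}) atTop (𝓝 0)

/-- Sub-Gaussian norm `sup_{q ≥ 1} q^{-1/2} (E|X|^q)^{1/q}` of a real random variable. -/
def subGaussNorm {Ω : Type*} [MeasurableSpace Ω] (P : Measure Ω) (X : Ω → ℝ) : ℝ≥0∞ :=
  ⨆ (q : ℝ) (_ : 1 ≤ q), ENNReal.ofReal (q ^ (-(1 / 2) : ℝ)) * eLpNorm X (ENNReal.ofReal q) P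

/-- Sub-Gaussian norm of a random vector: the supremum over `u` in the Euclidean unit sphere of
the sub-Gaussian norm of `uᵀ X`. -/
def subGaussNormVec {Ω : Type*} [MeasurableSpace Ω] {p : ℕ} (P : Measure Ω)
    (X : Ω → Fin p → ℝ) : ℝ≥0∞ :=
  ⨆ (u : Fin p → ℝ) (_ : u ⬝ᵥ u = 1), subGaussNorm P fun ω => u ⬝ᵥ X ω

/-- Symmetric matrices all of whose eigenvalues lie in `[k, 1/k]`. -/
def WellConditioned {p : ℕ} (k : ℝ) (Sig : Matrix (Fin p) (Fin p) ℝ) : Prop :=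
  ∃ h : Sig.IsHermitian, ∀ i, k ≤ h.eigenvalues i ∧ h.eigenvalues i ≤ 1 / k

/-- `Y₁, …, Yₙ` are i.i.d. random vectors with mean zero and covariance matrix `Sig0`, and
`Sig0^{-1/2} Yᵢ` has sub-Gaussian norm at most `σ₀`. -/
structure TrueModel {Ω : Type*} [MeasurableSpace Ω] {n p : ℕ} (P : Measure Ω)
    (Y : Fin n → Ω → Fin p → ℝ) (Sig0 : Matrix (Fin p) (Fin p) ℝ) (σ₀ : ℝ) : Prop where
  measurable : ∀ i, Measurable (Y i)
  indep : iIndepFun Y P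
  ident : ∀ i j, IdentDistrib (Y i) (Y j) P P
  mean : ∀ i a, ∫ ω, Y i ω a ∂P = 0
  cov : ∀ i a b, ∫ ω, Y i ω a * Y i ω b ∂P = Sig0 a b
  subGauss : ∀ i, subGaussNormVec P (fun ω => (CFC.sqrt Sig0)⁻¹ *ᵥ Y i ω) ≤ ENNReal.ofReal σ₀

/-- The posterior contracts around `Sig0` at rate `e n`: for every `M n → ∞`, the posterior
probability of `‖Σ - Σ₀‖ > M n * e n` tends to zero in probability. -/
def ContractsAtRate {Ω : ℕ → Type*} [∀ n, MeasurableSpace (Ω n)] (P : ∀ n, Measure (Ω n))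
    {p : ℕ → ℕ} (S : ∀ n, Ω n → Matrix (Fin (p n)) (Fin (p n)) ℝ)
    (f : ∀ n, Matrix (Fin (p n)) (Fin (p n)) ℝ → ℝ)
    (Sig0 : ∀ n, Matrix (Fin (p n)) (Fin (p n)) ℝ) (e : ℕ → ℝ) : Prop :=
  ∀ M : ℕ → ℝ, Tendsto M atTop atTop →
    TendstoZeroInProb P fun n ω =>
      posterior (f n) n (S n ω) {x | M n * e n < specNorm (unvech x - Sig0 n)}

/-- The prior densities are flat around `S` at rate `e n`: for every constant `M > 0`,
`ρ(M * e n)` tends to zero in probability. -/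
def FlatAround {Ω : ℕ → Type*} [∀ n, MeasurableSpace (Ω n)] (P : ∀ n, Measure (Ω n))
    {p : ℕ → ℕ} (S : ∀ n, Ω n → Matrix (Fin (p n)) (Fin (p n)) ℝ)
    (f : ∀ n, Matrix (Fin (p n)) (Fin (p n)) ℝ → ℝ) (e : ℕ → ℝ) : Prop :=
  ∀ M : ℝ, 0 < M → TendstoZeroInProb P fun n ω => flatness (f n) n (S n ω) (M * e n)

end BvM

end

open MeasureTheory ProbabilityTheory Filter Topology
open scoped ENNReal Matrix MatrixOrder Kronecker

namespace BvM

/-! Write `x i` for the eigenvalues of S^{-1/2} T S^{-1/2} / √n. The Gaussian log-likelihood ratio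
at S + T/√n depends on them alone: it equals -(n/2) ∑ (log (1 + x i) + 1/(1 + x i) - 1), and each
summand is (x i)²/2 + O(|x i|³). The quadratic part sums to -tr(S⁻¹TS⁻¹T)/4, which is exactly the
exponent of `phi S T`. This is `abs_logLik_sub_add_trace_le` combined with `phi_eq`.

On the spectral ball ‖T‖ ≤ M√p the cubic error is of order n p (p/n)^{3/2} = √(p⁵/n), so the growth
condition makes it vanish. The prior is nearly constant there, hence likelihood times prior is a
constant multiple of `phi`, up to a factor 1 ± δ. Both laws put nearly all their mass in the ball:
the posterior by contraction around Σ₀ and ‖S - Σ₀‖ = O(√(p/n)), the Gaussian by its exponential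
moments. Two measures almost proportional on a set carrying almost all of both are close in L¹ after
normalisation (`lintegral_abs_div_integral_sub_le`), and `l1Dist_le` collects this as a
deterministic bound.

The probabilistic input is one tail bound, `meas_le_specNorm_le`, applied both to S - Σ₀ and to the
limiting Gaussian matrix. Contraction is assumed only along diverging sequences of radii;
`exists_const_eventually_le` extracts from it one large constant radius, as flatness of the prior
requires. -/

/-! ### Spectral norm and quadratic forms. -/

theorem abs_dotProduct_mulVec_le {p : ℕ} (A : Matrix (Fin p) (Fin p) ℝ) (v : Fin p → ℝ) :
    |v ⬝ᵥ A *ᵥ v| ≤ specNorm A * (v ⬝ᵥ v) := by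
  have h1 := Matrix.inner_toEuclideanCLM A (WithLp.toLp 2 v) (WithLp.toLp 2 v)
  have h2 : ‖(WithLp.toLp 2 v : EuclideanSpace ℝ (Fin p))‖ ^ 2 = v ⬝ᵥ v := by
    rw [EuclideanSpace.real_norm_sq_eq]; simp [dotProduct, sq]
  simp only at h1
  rw [← h1, ← h2]
  refine (abs_real_inner_le_norm _ _).trans ?_
  have := (Matrix.toEuclideanCLM (n := Fin p) (𝕜 := ℝ) A).le_opNorm (WithLp.toLp 2 v)
  unfold specNorm
  nlinarith [norm_nonneg (WithLp.toLp 2 v : EuclideanSpace ℝ (Fin p))]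

theorem specNorm_nonneg {p : ℕ} (A : Matrix (Fin p) (Fin p) ℝ) : 0 ≤ specNorm A := norm_nonneg _

theorem specNorm_add_le {p : ℕ} (A B : Matrix (Fin p) (Fin p) ℝ) :
    specNorm (A + B) ≤ specNorm A + specNorm B := by
  unfold specNorm; rw [map_add]; exact norm_add_le _ _

theorem specNorm_smul {p : ℕ} (c : ℝ) (A : Matrix (Fin p) (Fin p) ℝ) :
    specNorm (c • A) = |c| * specNorm A := by
  unfold specNorm; rw [map_smul, norm_smul, Real.norm_eq_abs]

theorem specNorm_sub_comm {p : ℕ} (A B : Matrix (Fin p) (Fin p) ℝ) :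
    specNorm (A - B) = specNorm (B - A) := by
  unfold specNorm; rw [map_sub, map_sub, norm_sub_rev]

/-- The spectral norm of a symmetric matrix is nearly attained by its quadratic form. -/
theorem exists_unit_le_abs_inner {p : ℕ} (A : Matrix (Fin p) (Fin p) ℝ) (hA : A.IsSymm)
    (h0 : 0 < specNorm A) :
    ∃ v : EuclideanSpace ℝ (Fin p), ‖v‖ = 1 ∧
      9 / 10 * specNorm A ≤ |inner ℝ v (Matrix.toEuclideanCLM (n := Fin p) (𝕜 := ℝ) A v)| := by
  set T := Matrix.toEuclideanCLM (n := Fin p) (𝕜 := ℝ) A with hT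
  have hsym : T.IsSymmetric := by
    intro x y
    have h1 := Matrix.inner_toEuclideanCLM A x y
    have h2 := Matrix.inner_toEuclideanCLM A y x
    change inner ℝ (T x) y = inner ℝ x (T y)
    rw [real_inner_comm, hT, h1, h2, Matrix.dotProduct_mulVec, ← Matrix.mulVec_transpose, hA.eq,
      dotProduct_comm]
  have hne := ContinuousLinearMap.norm_eq_iSup_rayleighQuotient T hsym
  have hlt : 9 / 10 * specNorm A < ⨆ x, |T.rayleighQuotient x| := by
    rw [← hne]; change _ < specNorm A; linarith
  obtain ⟨x, hx⟩ := exists_lt_of_lt_ciSup hlt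
  have hx0 : x ≠ 0 := by
    rintro rfl
    rw [ContinuousLinearMap.rayleighQuotient_apply_zero] at hx
    simp at hx; linarith
  have hnx : ‖x‖ ≠ 0 := norm_ne_zero_iff.2 hx0
  refine ⟨(‖x‖⁻¹ : ℝ) • x, ?_, ?_⟩
  · rw [norm_smul, norm_inv, norm_norm, inv_mul_cancel₀ hnx]
  · refine hx.le.trans (le_of_eq ?_)
    rw [ContinuousLinearMap.rayleighQuotient, ContinuousLinearMap.reApplyInnerSelf_apply, map_smul,
      inner_smul_left, inner_smul_right, real_inner_comm]
    congr 1
    simp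
    field_simp

theorem dotProduct_self_eq_norm_sq {p : ℕ} (v : EuclideanSpace ℝ (Fin p)) :
    (v : Fin p → ℝ) ⬝ᵥ (v : Fin p → ℝ) = ‖v‖ ^ 2 := by
  rw [EuclideanSpace.real_norm_sq_eq]; simp [dotProduct, sq]

/-- Near a unit vector at which the quadratic form is almost maximal, the form remains large. -/
theorem exists_unit_forall_ball_le_abs {p : ℕ} (A : Matrix (Fin p) (Fin p) ℝ) (hA : A.IsSymm)
    (h0 : 0 < specNorm A) :
    ∃ v : EuclideanSpace ℝ (Fin p), ‖v‖ = 1 ∧ ∀ u ∈ Metric.ball v (1 / 4),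
      specNorm A / 4 ≤ |(u : Fin p → ℝ) ⬝ᵥ A *ᵥ (u : Fin p → ℝ)| := by
  obtain ⟨v, hv, hle⟩ := exists_unit_le_abs_inner A hA h0
  refine ⟨v, hv, fun u hu => ?_⟩
  have e := Matrix.inner_toEuclideanCLM A u u
  rw [← e]
  set T := Matrix.toEuclideanCLM (n := Fin p) (𝕜 := ℝ) A with hT
  have hw : ‖u - v‖ < 1 / 4 := by simpa [dist_eq_norm] using hu
  obtain ⟨w, rfl⟩ : ∃ w, u = v + w := ⟨u - v, by abel⟩
  have hw : ‖w‖ < 1 / 4 := by simpa using hw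
  have hn : ‖T‖ = specNorm A := rfl
  have bound : ∀ x y, |inner ℝ x (T y)| ≤ specNorm A * (‖x‖ * ‖y‖) := fun x y => by
    refine (abs_real_inner_le_norm _ _).trans ?_
    have := T.le_opNorm y
    rw [hn] at this
    nlinarith [norm_nonneg x]
  have h1 := bound v w
  have h2 := bound w v
  have h3 := bound w w
  rw [hv, one_mul] at h1
  rw [hv, mul_one] at h2
  have hw0 := norm_nonneg w
  have hs : specNorm A * ‖w‖ ≤ specNorm A * (1/4) := by gcongr
  have hs2 : specNorm A * (‖w‖ * ‖w‖) ≤ specNorm A * (1/4 * (1/4)) := by gcongr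
  have : inner ℝ (v + w) (T (v + w)) = inner ℝ v (T v) + (inner ℝ v (T w) + inner ℝ w (T v) + inner ℝ w (T w)) := by
    rw [map_add, inner_add_left, inner_add_right, inner_add_right]; ring
  rw [this]
  -- The cross terms cost at most 1/4 + 1/4 + 1/16 of the norm, and 9/10 - 9/16 > 1/4.
  have t := abs_sub_abs_le_abs_sub (inner ℝ v (T v)) (-(inner ℝ v (T w) + inner ℝ w (T v) + inner ℝ w (T w)))
  rw [sub_neg_eq_add, abs_neg] at t
  have t2 := (abs_add_three (inner ℝ v (T w)) (inner ℝ w (T v)) (inner ℝ w (T w)))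
  linarith

/-! ### Half-vectorised coordinates and simultaneous diagonalisation. -/

theorem unvech_isSymm {p : ℕ} (x : VechIdx p → ℝ) : (unvech x).IsSymm := by
  ext i j
  rw [Matrix.transpose_apply]
  unfold unvech
  by_cases h : j ≤ i
  · by_cases h' : i ≤ j
    · obtain rfl := le_antisymm h h'; rfl
    · simp [h, h']
  · have h' := (not_le.mp h).le
    simp [h, h']

theorem vech_unvech {p : ℕ} (x : VechIdx p → ℝ) : vech (unvech x) = x := by
  funext k; simp [vech, unvech, k.2]

theorem unvech_vech {p : ℕ} (A : Matrix (Fin p) (Fin p) ℝ) (hA : A.IsSymm) :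
    unvech (vech A) = A := by
  ext i j
  unfold unvech vech
  split_ifs
  · rfl
  · exact hA.apply _ _

theorem unvech_add {p : ℕ} (x y : VechIdx p → ℝ) : unvech (x + y) = unvech x + unvech y := by
  ext i j; simp only [unvech, Matrix.add_apply]; split_ifs <;> rfl

theorem unvech_smul {p : ℕ} (c : ℝ) (x : VechIdx p → ℝ) : unvech (c • x) = c • unvech x := by
  ext i j; simp only [unvech, Matrix.smul_apply]; split_ifs <;> rfl

@[fun_prop]
theorem continuous_unvech {p : ℕ} : Continuous (unvech : (VechIdx p → ℝ) → _) := by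
  refine continuous_pi fun i => continuous_pi fun j => ?_
  unfold unvech
  split_ifs <;> fun_prop

theorem continuous_specNorm {p : ℕ} : Continuous (specNorm : Matrix (Fin p) (Fin p) ℝ → ℝ) := by
  unfold specNorm
  refine continuous_norm.comp ?_
  exact LinearMap.continuous_of_finiteDimensional
    ((Matrix.toEuclideanCLM (n := Fin p) (𝕜 := ℝ)).toAlgEquiv.toLinearMap)

/-- Simultaneous diagonalisation by congruence of a positive definite and a symmetric matrix. -/
theorem exists_congr_diagonal {p : ℕ} {S T : Matrix (Fin p) (Fin p) ℝ} (hS : S.PosDef)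
    (hT : T.IsSymm) :
    ∃ (W : Matrix (Fin p) (Fin p) ℝ) (l : Fin p → ℝ), IsUnit W.det ∧ S = W * Wᵀ ∧
      T = W * Matrix.diagonal l * Wᵀ := by
  set R := CFC.sqrt S with hR
  have hRR : R * R = S := CFC.sqrt_mul_sqrt_self S hS.posSemidef.nonneg
  have hRsymm : Rᵀ = R := by
    have : R.PosSemidef := Matrix.nonneg_iff_posSemidef.1 (CFC.sqrt_nonneg S)
    simpa [Matrix.conjTranspose_eq_transpose_of_trivial] using this.isHermitian.eq
  have hRdet : IsUnit R.det := by
    have := hS.det_pos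
    rw [← hRR, Matrix.det_mul] at this
    exact isUnit_iff_ne_zero.2 fun h => by simp [h] at this
  -- With U diagonalising S^{-1/2} T S^{-1/2}, the congruence is W = S^{1/2} U.
  have hA : (R⁻¹ * T * R⁻¹).IsHermitian := by
    rw [Matrix.IsHermitian, Matrix.conjTranspose_eq_transpose_of_trivial, Matrix.transpose_mul,
      Matrix.transpose_mul, Matrix.transpose_nonsing_inv, hRsymm, hT.eq, Matrix.mul_assoc]
  set U : Matrix (Fin p) (Fin p) ℝ := ↑hA.eigenvectorUnitary with hU
  have hUU : U * Uᵀ = 1 := by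
    have := Unitary.coe_mul_star_self hA.eigenvectorUnitary
    simpa [Matrix.star_eq_conjTranspose, Matrix.conjTranspose_eq_transpose_of_trivial] using this
  have hsp : R⁻¹ * T * R⁻¹ = U * Matrix.diagonal hA.eigenvalues * Uᵀ := by
    have := hA.spectral_theorem
    rw [Unitary.conjStarAlgAut_apply] at this
    simpa [Matrix.star_eq_conjTranspose, Matrix.conjTranspose_eq_transpose_of_trivial,
      Function.comp_def] using this
  refine ⟨R * U, hA.eigenvalues, ?_, ?_, ?_⟩
  · rw [Matrix.det_mul]
    refine hRdet.mul ?_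
    have := congrArg Matrix.det hUU
    rw [Matrix.det_mul, Matrix.det_one] at this
    exact IsUnit.of_mul_eq_one _ this
  · rw [Matrix.transpose_mul, hRsymm, Matrix.mul_assoc, ← Matrix.mul_assoc U, hUU, Matrix.one_mul,
      hRR]
  · rw [Matrix.transpose_mul, hRsymm]
    have : R * U * Matrix.diagonal hA.eigenvalues * (Uᵀ * R) =
        R * (U * Matrix.diagonal hA.eigenvalues * Uᵀ) * R := by
      simp only [Matrix.mul_assoc]
    rw [this, ← hsp]
    have : R * (R⁻¹ * T * R⁻¹) * R = (R * R⁻¹) * T * (R⁻¹ * R) := by simp only [Matrix.mul_assoc]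
    rw [this, Matrix.mul_nonsing_inv _ hRdet, Matrix.nonsing_inv_mul _ hRdet, Matrix.one_mul,
      Matrix.mul_one]

/-! ### Tail of the spectral norm from exponential moments. -/

/-- Exponential moments of the quadratic forms of a random symmetric matrix, uniform over vectors of
norm at most two, control the tail of its spectral norm. -/
theorem meas_le_specNorm_le {Ω : Type*} [MeasurableSpace Ω] (μ : Measure Ω) [SFinite μ] {p : ℕ}
    (A : Ω → Matrix (Fin p) (Fin p) ℝ) (hA : ∀ i j, Measurable fun ω => A ω i j)
    (hsymm : ∀ ω, (A ω).IsSymm) {τ r : ℝ} (hτ : 0 < τ) (hr : 0 < r) (K : ℝ≥0∞)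
    (hK : ∀ u : Fin p → ℝ, u ⬝ᵥ u ≤ 4 → ∀ s : ℝ, |s| = τ →
      ∫⁻ ω, ENNReal.ofReal (Real.exp (s * (u ⬝ᵥ A ω *ᵥ u))) ∂μ ≤ K) :
    μ {ω | r ≤ specNorm (A ω)} ≤ 2 * K * 8 ^ p * ENNReal.ofReal (Real.exp (-(τ * r / 4))) := by
  let q : Ω → EuclideanSpace ℝ (Fin p) → ℝ := fun ω u => (u : Fin p → ℝ) ⬝ᵥ A ω *ᵥ (u : Fin p → ℝ)
  have hq : Measurable (Function.uncurry q) := by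
    simp only [q, Function.uncurry_def, dotProduct, Matrix.mulVec]
    refine Finset.measurable_sum _ fun i _ => ?_
    refine Measurable.mul (by fun_prop) (Finset.measurable_sum _ fun j _ => ?_)
    exact ((hA i j).comp measurable_fst).mul (by fun_prop)
  -- Both signs are needed, since the form may be large and negative at its extremal vector.
  let F : Ω → EuclideanSpace ℝ (Fin p) → ℝ≥0∞ := fun ω u =>
    ENNReal.ofReal (Real.exp (τ * q ω u)) + ENNReal.ofReal (Real.exp (-τ * q ω u))
  have hF : Measurable (Function.uncurry F) := by
    have h1 : Measurable fun z : Ω × EuclideanSpace ℝ (Fin p) => ENNReal.ofReal (Real.exp (τ * Function.uncurry q z)) := by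
      fun_prop
    have h2 : Measurable fun z : Ω × EuclideanSpace ℝ (Fin p) => ENNReal.ofReal (Real.exp (-τ * Function.uncurry q z)) := by
      fun_prop
    exact h1.add h2
  -- Averaging over the ball of radius 2 replaces a union bound over a net. If the norm is at least
  -- r, the form is at least r/4 in absolute value on a ball of radius 1/4 inside it; the ratio of
  -- volumes is 8^p.
  let ν : Measure (EuclideanSpace ℝ (Fin p)) := volume.restrict (Metric.ball 0 2)
  let g : Ω → ℝ≥0∞ := fun ω => ∫⁻ u, F ω u ∂ν
  have hg : Measurable g := hF.lintegral_prod_right'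
  set b : ℝ≥0∞ := volume (Metric.ball (0 : EuclideanSpace ℝ (Fin p)) 1) with hb
  have hb0 : b ≠ 0 := (Metric.measure_ball_pos volume _ one_pos).ne'
  have hbt : b ≠ ∞ := measure_ball_lt_top.ne
  have hfin : Module.finrank ℝ (EuclideanSpace ℝ (Fin p)) = p := by simp
  have hv2 : volume (Metric.ball (0 : EuclideanSpace ℝ (Fin p)) 2) = ENNReal.ofReal (2 ^ p) * b := by
    rw [Measure.addHaar_ball_of_pos volume (0 : EuclideanSpace ℝ (Fin p)) (by norm_num : (0:ℝ) < 2), hfin]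
  have hv4 : ∀ v : EuclideanSpace ℝ (Fin p), volume (Metric.ball v (1/4)) = ENNReal.ofReal ((1/4) ^ p) * b := fun v => by
    rw [Measure.addHaar_ball_of_pos volume v (by norm_num : (0:ℝ) < 1/4), hfin]
  have hupper : ∫⁻ ω, g ω ∂μ ≤ ENNReal.ofReal (2 ^ p) * b * (2 * K) := by
    rw [lintegral_lintegral_swap hF.aemeasurable]
    calc ∫⁻ u, ∫⁻ ω, F ω u ∂μ ∂ν ≤ ∫⁻ u, 2 * K ∂ν := by
          refine setLIntegral_mono' measurableSet_ball fun u hu => ?_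
          have hu4 : (u : Fin p → ℝ) ⬝ᵥ (u : Fin p → ℝ) ≤ 4 := by
            rw [dotProduct_self_eq_norm_sq]
            have : ‖u‖ < 2 := by simpa using hu
            nlinarith [norm_nonneg u]
          rw [lintegral_add_left, two_mul]
          · exact add_le_add (hK u hu4 τ (abs_of_pos hτ))
              (hK u hu4 (-τ) (by rw [abs_neg, abs_of_pos hτ]))
          · have : Measurable fun ω => q ω u := hq.comp (measurable_id.prodMk measurable_const)
            fun_prop
      _ = ENNReal.ofReal (2 ^ p) * b * (2 * K) := by
          rw [lintegral_const, Measure.restrict_apply MeasurableSet.univ, Set.univ_inter, hv2,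
            mul_comm]
  set c : ℝ≥0∞ := ENNReal.ofReal ((1/4) ^ p) * b * ENNReal.ofReal (Real.exp (τ * r / 4)) with hc
  have hlower : ∀ ω, r ≤ specNorm (A ω) → c ≤ g ω := by
    intro ω hω
    obtain ⟨v, hv, hball⟩ := exists_unit_forall_ball_le_abs (A ω) (hsymm ω) (hr.trans_le hω)
    have hsub : Metric.ball v (1/4) ⊆ Metric.ball (0 : EuclideanSpace ℝ (Fin p)) 2 := by
      refine Metric.ball_subset_ball' ?_
      rw [dist_zero_right, hv]; norm_num
    calc c = ∫⁻ u in Metric.ball v (1/4), ENNReal.ofReal (Real.exp (τ * r / 4)) := by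
          rw [setLIntegral_const, hv4, mul_comm]
      _ ≤ ∫⁻ u in Metric.ball v (1/4), F ω u := by
          refine setLIntegral_mono' measurableSet_ball fun u hu => ?_
          have h1 := hball u hu
          have h2 : r / 4 ≤ |q ω u| := by
            refine le_trans ?_ h1; linarith
          rcases le_abs.1 h2 with h3 | h3
          · refine le_add_right (ENNReal.ofReal_le_ofReal (Real.exp_le_exp.2 ?_))
            nlinarith
          · refine le_add_left (ENNReal.ofReal_le_ofReal (Real.exp_le_exp.2 ?_))
            nlinarith
      _ ≤ g ω := lintegral_mono_set hsub
  have hmarkov : c * μ {ω | r ≤ specNorm (A ω)} ≤ ENNReal.ofReal (2 ^ p) * b * (2 * K) :=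
    calc c * μ {ω | r ≤ specNorm (A ω)} ≤ c * μ {ω | c ≤ g ω} := by
          gcongr with ω; exact hlower ω
      _ ≤ ∫⁻ ω, g ω ∂μ := mul_meas_ge_le_lintegral hg c
      _ ≤ _ := hupper
  set X := μ {ω | r ≤ specNorm (A ω)}
  have hexp : ENNReal.ofReal (Real.exp (-(τ * r / 4))) * ENNReal.ofReal (Real.exp (τ * r / 4)) = 1 := by
    rw [← ENNReal.ofReal_mul (Real.exp_nonneg _), ← Real.exp_add]; simp
  have h4 : (4 : ℝ≥0∞) ^ p * ENNReal.ofReal ((1/4) ^ p) = 1 := by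
    have : (4 : ℝ≥0∞) = ENNReal.ofReal 4 := by simp
    rw [this, ← ENNReal.ofReal_pow (by norm_num), ← ENNReal.ofReal_mul (by positivity), ← mul_pow]
    norm_num
  have h2 : ENNReal.ofReal ((2:ℝ) ^ p) = 2 ^ p := by
    rw [ENNReal.ofReal_pow (by norm_num)]; simp
  calc X = (b⁻¹ * b) * (ENNReal.ofReal (Real.exp (-(τ * r / 4))) * ENNReal.ofReal (Real.exp (τ * r / 4)))
        * ((4 : ℝ≥0∞) ^ p * ENNReal.ofReal ((1/4) ^ p)) * X := by
          rw [ENNReal.inv_mul_cancel hb0 hbt, hexp, h4]; simp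
    _ = b⁻¹ * ENNReal.ofReal (Real.exp (-(τ * r / 4))) * 4 ^ p * (c * X) := by rw [hc]; ring
    _ ≤ b⁻¹ * ENNReal.ofReal (Real.exp (-(τ * r / 4))) * 4 ^ p *
        (ENNReal.ofReal (2 ^ p) * b * (2 * K)) := by gcongr
    _ = (b⁻¹ * b) * (2 * K * (4 * 2) ^ p * ENNReal.ofReal (Real.exp (-(τ * r / 4)))) := by
        rw [h2, mul_pow]; ring
    _ = _ := by rw [ENNReal.inv_mul_cancel hb0 hbt, one_mul]; norm_num

/-! ### Exponential moments of squares of sub-Gaussian variables. -/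

theorem exp_le_one_add_add_sq_mul (x : ℝ) : Real.exp x ≤ 1 + x + x ^ 2 * Real.exp |x| := by
  have h1 : Real.exp x - 1 ≤ x * Real.exp x := by
    have h := mul_le_mul_of_nonneg_right (Real.one_sub_le_exp_neg x) (Real.exp_nonneg x)
    rw [← Real.exp_add, neg_add_cancel, Real.exp_zero] at h
    linarith
  rcases le_total 0 x with h | h
  · rw [abs_of_nonneg h]
    nlinarith
  · have h2 : x ≤ Real.exp x - 1 := by linarith [Real.add_one_le_exp x]
    have h3 : 1 ≤ Real.exp |x| := Real.one_le_exp (abs_nonneg x)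
    nlinarith [sq_nonneg x, mul_le_mul_of_nonpos_left h2 h]

/-- Half of the exponent s₀|z| absorbs the quadratic factor of the remainder, through t² ≤ 8
exp(t/2), and the other half absorbs exp|sz|. The factor (s/s₀)² is what gives a Gaussian-type bound
for small s. -/
theorem exp_mul_le_of_two_mul_abs_le {s s₀ : ℝ} (hs₀ : 0 < s₀) (hs : 2 * |s| ≤ s₀) (z : ℝ) :
    Real.exp (s * z) ≤ 1 + s * z + 8 * (s / s₀) ^ 2 * Real.exp (s₀ * |z|) := by
  refine (exp_le_one_add_add_sq_mul _).trans ?_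
  have h1 : (s * z) ^ 2 = (s / s₀) ^ 2 * (s₀ * |z|) ^ 2 := by
    rw [mul_pow s₀, sq_abs]; field_simp
  have h2 : |s * z| ≤ s₀ * |z| / 2 := by
    rw [abs_mul]; nlinarith [abs_nonneg z]
  have h3 : (s₀ * |z|) ^ 2 ≤ 8 * Real.exp (s₀ * |z| / 2) := by
    have := Real.quadratic_le_exp_of_nonneg (x := s₀ * |z| / 2) (by positivity)
    have : 0 ≤ s₀ * |z| := by positivity
    nlinarith
  have h4 : Real.exp (s₀ * |z|) = Real.exp (s₀ * |z| / 2) * Real.exp (s₀ * |z| / 2) := by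
    rw [← Real.exp_add]; ring_nf
  have h5 : (s₀ * |z|) ^ 2 * Real.exp |s * z| ≤ 8 * Real.exp (s₀ * |z|) := by
    rw [h4, ← mul_assoc]
    exact mul_le_mul h3 (Real.exp_le_exp.2 h2) (Real.exp_nonneg _) (by positivity)
  rw [h1, mul_assoc]
  nlinarith [sq_nonneg (s / s₀)]

/-- The exponent q = 2k in the defining supremum; these even moments are the terms of the power
series of exp(s X²). -/
theorem lintegral_pow_le_of_subGaussNorm_le {Ω : Type*} [MeasurableSpace Ω] {P : Measure Ω}
    [IsProbabilityMeasure P] {X : Ω → ℝ} {σ : ℝ} (hσ : 0 < σ)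
    (h : subGaussNorm P X ≤ ENNReal.ofReal σ) (k : ℕ) :
    ∫⁻ ω, ENNReal.ofReal (X ω ^ (2 * k)) ∂P ≤ ENNReal.ofReal ((2 * σ ^ 2) ^ k * (k : ℝ) ^ k) := by
  rcases Nat.eq_zero_or_pos k with rfl | hk
  · simp
  have hk' : (1 : ℝ) ≤ k := by exact_mod_cast hk
  set q : ℝ := 2 * k with hq
  have hq1 : 1 ≤ q := by linarith
  have hq0 : 0 < q := by linarith
  have h1 : ENNReal.ofReal (q ^ (-(1 / 2) : ℝ)) * eLpNorm X (ENNReal.ofReal q) P ≤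
      ENNReal.ofReal σ := (le_iSup₂ (f := fun (q : ℝ) (_ : 1 ≤ q) =>
        ENNReal.ofReal (q ^ (-(1 / 2) : ℝ)) * eLpNorm X (ENNReal.ofReal q) P) q hq1).trans h
  rw [eLpNorm_eq_lintegral_rpow_enorm_toReal (by simpa using hq0) (by simp),
    ENNReal.toReal_ofReal hq0.le] at h1
  have h2 := ENNReal.rpow_le_rpow h1 hq0.le
  rw [ENNReal.mul_rpow_of_nonneg _ _ hq0.le, ← ENNReal.rpow_mul, one_div_mul_cancel hq0.ne',
    ENNReal.rpow_one, ENNReal.ofReal_rpow_of_nonneg (by positivity) hq0.le,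
    ENNReal.ofReal_rpow_of_nonneg hσ.le hq0.le, ← Real.rpow_mul hq0.le] at h2
  have e1 : q ^ (-(1 / 2) * q) = (q ^ k)⁻¹ := by
    rw [hq, show -(1 / 2) * (2 * (k : ℝ)) = -(k : ℝ) by ring, Real.rpow_neg (by positivity),
      Real.rpow_natCast]
  have e2 : σ ^ q = (σ ^ 2) ^ k := by
    rw [hq, ← pow_mul, ← Real.rpow_natCast]; push_cast; rfl
  have e3 : ∀ ω, ‖X ω‖ₑ ^ q = ENNReal.ofReal (X ω ^ (2 * k)) := fun ω => by
    rw [Real.enorm_eq_ofReal_abs, ENNReal.ofReal_rpow_of_nonneg (abs_nonneg _) hq0.le, hq]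
    congr 1
    rw [show (2 * (k : ℝ)) = ((2 * k : ℕ) : ℝ) by push_cast; rfl, Real.rpow_natCast,
      Even.pow_abs (by simp)]
  simp_rw [e1, e2, e3] at h2
  have hqk : 0 < q ^ k := by positivity
  calc ∫⁻ ω, ENNReal.ofReal (X ω ^ (2 * k)) ∂P
      = ENNReal.ofReal (q ^ k) * (ENNReal.ofReal (q ^ k)⁻¹ *
          ∫⁻ ω, ENNReal.ofReal (X ω ^ (2 * k)) ∂P) := by
        rw [← mul_assoc, ← ENNReal.ofReal_mul hqk.le, mul_inv_cancel₀ hqk.ne']; simp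
    _ ≤ ENNReal.ofReal (q ^ k) * ENNReal.ofReal ((σ ^ 2) ^ k) := by gcongr
    _ = _ := by
        rw [← ENNReal.ofReal_mul hqk.le, hq]; congr 1; simp only [mul_pow]; ring

/-- The square of a sub-Gaussian variable has an exponential moment. -/
theorem lintegral_exp_mul_sq_le_two {Ω : Type*} [MeasurableSpace Ω] {P : Measure Ω}
    [IsProbabilityMeasure P] {X : Ω → ℝ} (hX : Measurable X) {σ s : ℝ} (hσ : 0 < σ)
    (h : subGaussNorm P X ≤ ENNReal.ofReal σ) (hs : 0 ≤ s)
    (hs' : s * (4 * Real.exp 1 * σ ^ 2) ≤ 1) :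
    ∫⁻ ω, ENNReal.ofReal (Real.exp (s * X ω ^ 2)) ∂P ≤ 2 := by
  have hsum : ∀ y : ℝ, HasSum (fun n : ℕ => y ^ n / (n.factorial : ℝ)) (Real.exp y) := fun y => by
    rw [Real.exp_eq_exp_ℝ]; exact NormedSpace.expSeries_div_hasSum_exp y
  -- One term of the series of e^k.
  have hpow : ∀ k : ℕ, (k : ℝ) ^ k / (k.factorial : ℝ) ≤ Real.exp 1 ^ k := fun k => by
    rw [← Real.exp_nat_mul, mul_one]
    exact le_hasSum (hsum k) k fun i _ => by positivity
  have e1 : ∀ ω, ENNReal.ofReal (Real.exp (s * X ω ^ 2)) =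
      ∑' k : ℕ, ENNReal.ofReal (s ^ k / (k.factorial : ℝ)) * ENNReal.ofReal (X ω ^ (2 * k)) := by
    intro ω
    rw [← (hsum _).tsum_eq, ENNReal.ofReal_tsum_of_nonneg (fun k => by positivity) (hsum _).summable]
    congr 1; funext k
    rw [← ENNReal.ofReal_mul (by positivity)]
    congr 1; rw [mul_pow, pow_mul]; ring
  simp_rw [e1]
  rw [lintegral_tsum fun k => by fun_prop]
  -- The series is dominated by a geometric one of ratio 2eσ²s, and `hs'` says that this ratio is at
  -- most 1/2.
  have e2 : ∀ k : ℕ, ∫⁻ ω, ENNReal.ofReal (s ^ k / (k.factorial : ℝ)) *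
      ENNReal.ofReal (X ω ^ (2 * k)) ∂P ≤ (2⁻¹ : ℝ≥0∞) ^ k := fun k => by
    rw [lintegral_const_mul _ (by fun_prop)]
    calc _ ≤ ENNReal.ofReal (s ^ k / (k.factorial : ℝ)) *
          ENNReal.ofReal ((2 * σ ^ 2) ^ k * (k : ℝ) ^ k) := by
            gcongr; exact lintegral_pow_le_of_subGaussNorm_le hσ h k
      _ = ENNReal.ofReal ((s * (2 * σ ^ 2)) ^ k * ((k : ℝ) ^ k / (k.factorial : ℝ))) := by
            rw [← ENNReal.ofReal_mul (by positivity)]; congr 1; rw [mul_pow s]; ring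
      _ ≤ ENNReal.ofReal ((2⁻¹ : ℝ) ^ k) := by
            refine ENNReal.ofReal_le_ofReal ?_
            calc _ ≤ (s * (2 * σ ^ 2)) ^ k * Real.exp 1 ^ k := by
                  gcongr; exact hpow k
              _ = (s * (2 * σ ^ 2) * Real.exp 1) ^ k := (mul_pow _ _ _).symm
              _ ≤ _ := by gcongr; linarith
      _ = _ := by rw [ENNReal.ofReal_pow (by norm_num)]; congr 1; rw [ENNReal.ofReal_inv_of_pos] <;> simp
  calc _ ≤ ∑' k : ℕ, (2⁻¹ : ℝ≥0∞) ^ k := ENNReal.tsum_le_tsum e2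
    _ = 2 := by rw [ENNReal.tsum_geometric]; simp

/-- Bernstein-type bound on the moment generating function of a centred square. -/
theorem mgf_sq_sub_le {Ω : Type*} [MeasurableSpace Ω] {P : Measure Ω}
    [IsProbabilityMeasure P] {X : Ω → ℝ} (hX : Measurable X) {s₀ : ℝ} (hs₀ : 0 < s₀)
    (h : ∫⁻ ω, ENNReal.ofReal (Real.exp (s₀ * X ω ^ 2)) ∂P ≤ 2) {s : ℝ} (hs : 2 * |s| ≤ s₀) :
    Integrable (fun ω => X ω ^ 2) P ∧
    Integrable (fun ω => Real.exp (s * (X ω ^ 2 - ∫ ω, X ω ^ 2 ∂P))) P ∧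
    mgf (fun ω => X ω ^ 2 - ∫ ω, X ω ^ 2 ∂P) P s ≤ Real.exp (48 * (s / s₀) ^ 2) := by
  have hmeas : Measurable fun ω => Real.exp (s₀ * X ω ^ 2) := by fun_prop
  have hint : Integrable (fun ω => Real.exp (s₀ * X ω ^ 2)) P := by
    refine ⟨hmeas.aestronglyMeasurable, ?_⟩
    rw [hasFiniteIntegral_iff_ofReal (ae_of_all _ fun ω => Real.exp_nonneg _)]
    exact h.trans_lt (by simp)
  have hle : ∫ ω, Real.exp (s₀ * X ω ^ 2) ∂P ≤ 2 := by
    rw [integral_eq_lintegral_of_nonneg_ae (ae_of_all _ fun ω => Real.exp_nonneg _)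
      hmeas.aestronglyMeasurable]
    exact ENNReal.toReal_le_of_le_ofReal (by norm_num) (by simpa using h)
  have hsq : Integrable (fun ω => X ω ^ 2) P := by
    refine (hint.const_mul s₀⁻¹).mono' (by fun_prop) (ae_of_all _ fun ω => ?_)
    rw [Real.norm_of_nonneg (sq_nonneg _), ← div_eq_inv_mul, le_div_iff₀ hs₀]
    linarith [Real.add_one_le_exp (s₀ * X ω ^ 2)]
  set m := ∫ ω, X ω ^ 2 ∂P with hm
  have hm0 : 0 ≤ m := integral_nonneg fun ω => sq_nonneg _
  -- From 1 + y ≤ e^y. Centring then costs at most a factor e, and 2e ≤ 6 leads to the constant 48 =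
  -- 8 · 6.
  have hsm : s₀ * m ≤ 1 := by
    have h1 : ∫ ω, (1 + s₀ * X ω ^ 2) ∂P ≤ ∫ ω, Real.exp (s₀ * X ω ^ 2) ∂P := by
      refine integral_mono ((integrable_const _).add (hsq.const_mul _)) hint fun ω => ?_
      linarith [Real.add_one_le_exp (s₀ * X ω ^ 2)]
    rw [integral_add (integrable_const _) (hsq.const_mul _), integral_const_mul] at h1
    simp only [integral_const, probReal_univ, one_smul] at h1
    linarith
  have habs : ∀ ω, Real.exp (s₀ * |X ω ^ 2 - m|) ≤ Real.exp 1 * Real.exp (s₀ * X ω ^ 2) := by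
    intro ω
    rw [← Real.exp_add]
    refine Real.exp_le_exp.2 ?_
    have : |X ω ^ 2 - m| ≤ X ω ^ 2 + m := by
      rw [abs_le]; constructor <;> nlinarith [sq_nonneg (X ω)]
    nlinarith
  have hintabs : Integrable (fun ω => Real.exp (s₀ * |X ω ^ 2 - m|)) P :=
    (hint.const_mul _).mono' (by fun_prop) (ae_of_all _ fun ω => by
      rw [Real.norm_of_nonneg (Real.exp_nonneg _)]; exact habs ω)
  have hintabs_le : ∫ ω, Real.exp (s₀ * |X ω ^ 2 - m|) ∂P ≤ 6 := by
    calc _ ≤ ∫ ω, Real.exp 1 * Real.exp (s₀ * X ω ^ 2) ∂P :=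
          integral_mono hintabs (hint.const_mul _) habs
      _ = Real.exp 1 * ∫ ω, Real.exp (s₀ * X ω ^ 2) ∂P := integral_const_mul _ _
      _ ≤ Real.exp 1 * 2 := by gcongr
      _ ≤ 6 := by linarith [Real.exp_one_lt_d9]
  have hintexp : Integrable (fun ω => Real.exp (s * (X ω ^ 2 - m))) P := by
    refine hintabs.mono' (by fun_prop) (ae_of_all _ fun ω => ?_)
    rw [Real.norm_of_nonneg (Real.exp_nonneg _)]
    refine Real.exp_le_exp.2 ((le_abs_self _).trans ?_)
    rw [abs_mul]
    exact mul_le_mul_of_nonneg_right (by linarith [abs_nonneg s]) (abs_nonneg _)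
  refine ⟨hsq, hintexp, ?_⟩
  have hcen : Integrable (fun ω => X ω ^ 2 - m) P := hsq.sub (integrable_const _)
  have hlin : Integrable (fun ω => 1 + s * (X ω ^ 2 - m)) P :=
    (integrable_const _).add (hcen.const_mul _)
  calc mgf (fun ω => X ω ^ 2 - m) P s
      ≤ ∫ ω, (1 + s * (X ω ^ 2 - m) + 8 * (s / s₀) ^ 2 * Real.exp (s₀ * |X ω ^ 2 - m|)) ∂P :=
        integral_mono hintexp (hlin.add (hintabs.const_mul _))
          fun ω => exp_mul_le_of_two_mul_abs_le hs₀ hs _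
    _ = 1 + 8 * (s / s₀) ^ 2 * ∫ ω, Real.exp (s₀ * |X ω ^ 2 - m|) ∂P := by
        rw [integral_add hlin (hintabs.const_mul _), integral_const_mul,
          integral_add (integrable_const _) (hcen.const_mul _),
          integral_const_mul, integral_sub hsq (integrable_const _), ← hm]
        simp
    _ ≤ 1 + 48 * (s / s₀) ^ 2 := by nlinarith [sq_nonneg (s / s₀)]
    _ ≤ _ := by linarith [Real.add_one_le_exp (48 * (s / s₀) ^ 2)]

/-! ### Concentration of the sample covariance matrix. -/

theorem WellConditioned.posDef {p : ℕ} {k : ℝ} (hk : 0 < k) {A : Matrix (Fin p) (Fin p) ℝ}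
    (h : WellConditioned k A) : A.PosDef := by
  obtain ⟨hA, h⟩ := h
  exact hA.posDef_iff_eigenvalues_pos.2 fun i => hk.trans_le (h i).1

theorem WellConditioned.dotProduct_bounds {p : ℕ} {k : ℝ} {A : Matrix (Fin p) (Fin p) ℝ}
    (h : WellConditioned k A) (v : Fin p → ℝ) :
    k * (v ⬝ᵥ v) ≤ v ⬝ᵥ A *ᵥ v ∧ v ⬝ᵥ A *ᵥ v ≤ 1 / k * (v ⬝ᵥ v) := by
  obtain ⟨hA, h⟩ := h
  set U : Matrix (Fin p) (Fin p) ℝ := ↑hA.eigenvectorUnitary with hU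
  have hUU : U * Uᵀ = 1 := by
    have := Unitary.coe_mul_star_self hA.eigenvectorUnitary
    simpa [Matrix.star_eq_conjTranspose, Matrix.conjTranspose_eq_transpose_of_trivial] using this
  have hsp : A = U * Matrix.diagonal hA.eigenvalues * Uᵀ := by
    have := hA.spectral_theorem
    rw [Unitary.conjStarAlgAut_apply] at this
    simpa [Matrix.star_eq_conjTranspose, Matrix.conjTranspose_eq_transpose_of_trivial,
      Function.comp_def] using this
  set y := Uᵀ *ᵥ v with hy
  have e1 : v ⬝ᵥ A *ᵥ v = ∑ i, hA.eigenvalues i * y i ^ 2 := by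
    have : v ⬝ᵥ A *ᵥ v = y ⬝ᵥ Matrix.diagonal hA.eigenvalues *ᵥ y := by
      conv_lhs => rw [hsp]
      rw [hy, ← Matrix.mulVec_mulVec, ← Matrix.mulVec_mulVec, Matrix.dotProduct_mulVec,
        ← Matrix.mulVec_transpose]
    rw [this, dotProduct]
    refine Finset.sum_congr rfl fun i _ => ?_
    rw [Matrix.mulVec_diagonal]; ring
  have e2 : v ⬝ᵥ v = ∑ i, y i ^ 2 := by
    have : v ⬝ᵥ v = y ⬝ᵥ y := by
      rw [hy, Matrix.dotProduct_mulVec, Matrix.vecMul_transpose, Matrix.mulVec_mulVec, hUU,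
        Matrix.one_mulVec]
    rw [this, dotProduct]
    exact Finset.sum_congr rfl fun i _ => (sq _).symm
  rw [e1, e2, Finset.mul_sum, Finset.mul_sum]
  exact ⟨Finset.sum_le_sum fun i _ => mul_le_mul_of_nonneg_right (h i).1 (sq_nonneg _),
    Finset.sum_le_sum fun i _ => mul_le_mul_of_nonneg_right (h i).2 (sq_nonneg _)⟩

theorem sampleCov_isSymm {n p : ℕ} (y : Fin n → Fin p → ℝ) : (sampleCov y).IsSymm := by
  ext i j
  simp [sampleCov, Matrix.sum_apply, Matrix.vecMulVec_apply, mul_comm]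

theorem dotProduct_sampleCov_mulVec {n p : ℕ} (y : Fin n → Fin p → ℝ) (u : Fin p → ℝ) :
    u ⬝ᵥ sampleCov y *ᵥ u = (1 / (n : ℝ)) * ∑ i, (u ⬝ᵥ y i) ^ 2 := by
  rw [sampleCov, Matrix.smul_mulVec, dotProduct_smul, smul_eq_mul, Matrix.sum_mulVec,
    dotProduct_sum]
  congr 1
  refine Finset.sum_congr rfl fun i _ => ?_
  rw [Matrix.vecMulVec_mulVec]
  rw [dotProduct_smul, dotProduct_comm (y i) u, sq]
  rfl

/-- Here uᵀY = wᵀ(Σ₀^{-1/2}Y) with w = Σ₀^{1/2}u, and |w|² ≤ 4/k. The sub-Gaussian bound applies to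
w/|w|, and 16 is the product of this 4 with the 4 in `lintegral_exp_mul_sq_le_two`. -/
theorem TrueModel.lintegral_exp_sq_le {Ω : Type*} [MeasurableSpace Ω] {n p : ℕ} {P : Measure Ω}
    [IsProbabilityMeasure P] {Y : Fin n → Ω → Fin p → ℝ} {Sig0 : Matrix (Fin p) (Fin p) ℝ}
    {σ₀ k : ℝ} (hσ₀ : 0 < σ₀) (hk : 0 < k) (hc : WellConditioned k Sig0)
    (h : TrueModel P Y Sig0 σ₀) (i : Fin n) (u : Fin p → ℝ) (hu : u ⬝ᵥ u ≤ 4) :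
    ∫⁻ ω, ENNReal.ofReal (Real.exp (k / (16 * Real.exp 1 * σ₀ ^ 2) * (u ⬝ᵥ Y i ω) ^ 2)) ∂P
      ≤ 2 := by
  have hpd := hc.posDef hk
  set R := CFC.sqrt Sig0 with hR
  have hRR : R * R = Sig0 := CFC.sqrt_mul_sqrt_self Sig0 hpd.posSemidef.nonneg
  have hRsymm : Rᵀ = R := by
    have : R.PosSemidef := Matrix.nonneg_iff_posSemidef.1 (CFC.sqrt_nonneg Sig0)
    simpa [Matrix.conjTranspose_eq_transpose_of_trivial] using this.isHermitian.eq
  have hRdet : IsUnit R.det := by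
    have := hpd.det_pos
    rw [← hRR, Matrix.det_mul] at this
    exact isUnit_iff_ne_zero.2 fun h => by simp [h] at this
  set w := R *ᵥ u with hw
  have hww : w ⬝ᵥ w = u ⬝ᵥ Sig0 *ᵥ u := by
    rw [← hRR, ← Matrix.mulVec_mulVec, Matrix.dotProduct_mulVec u, ← Matrix.mulVec_transpose, hRsymm]
  have hwle : w ⬝ᵥ w ≤ 4 / k := by
    rw [hww]
    refine (hc.dotProduct_bounds u).2.trans ?_
    rw [div_mul_eq_mul_div, one_mul]; gcongr
  have hww0 : 0 ≤ w ⬝ᵥ w := by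
    rw [dotProduct]; exact Finset.sum_nonneg fun i _ => mul_self_nonneg _
  have huY : ∀ ω, u ⬝ᵥ Y i ω = w ⬝ᵥ (R⁻¹ *ᵥ Y i ω) := fun ω => by
    rw [hw, Matrix.dotProduct_mulVec, ← Matrix.mulVec_transpose, Matrix.mulVec_mulVec,
      Matrix.transpose_nonsing_inv, hRsymm, Matrix.nonsing_inv_mul _ hRdet, Matrix.one_mulVec]
  by_cases hw0 : w = 0
  · simp_rw [huY, hw0]; simp
  have hwpos : 0 < w ⬝ᵥ w := lt_of_le_of_ne hww0 fun h => hw0 (dotProduct_self_eq_zero.1 h.symm)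
  set c := Real.sqrt (w ⬝ᵥ w) with hc'
  have hc0 : 0 < c := Real.sqrt_pos.2 hwpos
  have hcc : c ^ 2 = w ⬝ᵥ w := Real.sq_sqrt hww0
  set e : Fin p → ℝ := c⁻¹ • w with he
  have hee : e ⬝ᵥ e = 1 := by
    rw [he, smul_dotProduct, dotProduct_smul, smul_eq_mul, smul_eq_mul, ← hcc]; field_simp
  have hsub : subGaussNorm P (fun ω => e ⬝ᵥ (R⁻¹ *ᵥ Y i ω)) ≤ ENNReal.ofReal σ₀ :=
    (le_iSup₂ (f := fun (u : Fin p → ℝ) (_ : u ⬝ᵥ u = 1) =>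
      subGaussNorm P fun ω => u ⬝ᵥ (R⁻¹ *ᵥ Y i ω)) e hee).trans (h.subGauss i)
  have hm : Measurable fun ω => e ⬝ᵥ (R⁻¹ *ᵥ Y i ω) := by
    have hY := h.measurable i
    simp only [dotProduct, Matrix.mulVec]
    fun_prop
  have hexp : 0 < Real.exp 1 := Real.exp_pos 1
  have key := lintegral_exp_mul_sq_le_two hm hσ₀ hsub
    (s := k / (16 * Real.exp 1 * σ₀ ^ 2) * c ^ 2) (by positivity) (by
      rw [hcc]
      calc k / (16 * Real.exp 1 * σ₀ ^ 2) * (w ⬝ᵥ w) * (4 * Real.exp 1 * σ₀ ^ 2)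
          = k / 4 * (w ⬝ᵥ w) := by field_simp; ring
        _ ≤ k / 4 * (4 / k) := by gcongr
        _ = 1 := by field_simp)
  refine le_trans (le_of_eq ?_) key
  refine lintegral_congr fun ω => ?_
  rw [huY, he, smul_dotProduct, smul_eq_mul]
  congr 2
  field_simp

theorem TrueModel.integral_sq {Ω : Type*} [MeasurableSpace Ω] {n p : ℕ} {P : Measure Ω}
    [IsProbabilityMeasure P] {Y : Fin n → Ω → Fin p → ℝ} {Sig0 : Matrix (Fin p) (Fin p) ℝ}
    {σ₀ k : ℝ} (hσ₀ : 0 < σ₀) (hk : 0 < k) (hc : WellConditioned k Sig0)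
    (h : TrueModel P Y Sig0 σ₀) (i : Fin n) (u : Fin p → ℝ) :
    ∫ ω, (u ⬝ᵥ Y i ω) ^ 2 ∂P = u ⬝ᵥ Sig0 *ᵥ u := by
  have hY := h.measurable i
  have hs : 0 < k / (16 * Real.exp 1 * σ₀ ^ 2) := by have := Real.exp_pos 1; positivity
  -- The equation `h.cov` does not give integrability, as Bochner integrals of non-integrable
  -- functions are zero. It is drawn from the exponential moment along a coordinate vector; only the
  -- first conclusion of `mgf_sq_sub_le` is needed, so s = 0 suffices.
  have hL2 : ∀ a, MemLp (fun ω => Y i ω a) 2 P := fun a => by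
    have h1 := h.lintegral_exp_sq_le hσ₀ hk hc i (Pi.single a 1) (by simp)
    have h2 := (mgf_sq_sub_le (X := fun ω => Pi.single a 1 ⬝ᵥ Y i ω)
      (by simp only [dotProduct]; fun_prop) hs h1 (s := 0) (by simpa using hs.le)).1
    simp only [single_dotProduct, one_mul] at h2
    exact (memLp_two_iff_integrable_sq (by fun_prop)).2 h2
  have hint : ∀ a b, Integrable (fun ω => Y i ω a * Y i ω b) P := fun a b =>
    (hL2 a).integrable_mul (hL2 b)
  have e : ∀ ω, (u ⬝ᵥ Y i ω) ^ 2 = ∑ a, ∑ b, u a * u b * (Y i ω a * Y i ω b) := fun ω => by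
    rw [sq, dotProduct, Finset.sum_mul_sum]
    refine Finset.sum_congr rfl fun a _ => Finset.sum_congr rfl fun b _ => by ring
  simp_rw [e]
  rw [integral_finsetSum _ fun a _ => integrable_finsetSum _ fun b _ => (hint a b).const_mul _]
  rw [dotProduct]
  refine Finset.sum_congr rfl fun a _ => ?_
  rw [integral_finsetSum _ fun b _ => (hint a b).const_mul _, Matrix.mulVec, dotProduct,
    Finset.mul_sum]
  refine Finset.sum_congr rfl fun b _ => ?_
  rw [integral_const_mul, h.cov]; ring

/-- The quantity n uᵀ(S - Σ₀)u is a sum of n independent centred squares, so the bounds on the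
moment generating functions multiply. -/
theorem TrueModel.lintegral_exp_sampleCov_le {Ω : Type*} [MeasurableSpace Ω] {n p : ℕ}
    {P : Measure Ω} [IsProbabilityMeasure P] {Y : Fin n → Ω → Fin p → ℝ}
    {Sig0 : Matrix (Fin p) (Fin p) ℝ} {σ₀ k : ℝ} (hσ₀ : 0 < σ₀) (hk : 0 < k)
    (hc : WellConditioned k Sig0) (h : TrueModel P Y Sig0 σ₀) (hn : 0 < n) (u : Fin p → ℝ)
    (hu : u ⬝ᵥ u ≤ 4) (s : ℝ) (hs : 2 * |s| ≤ k / (16 * Real.exp 1 * σ₀ ^ 2)) :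
    ∫⁻ ω, ENNReal.ofReal (Real.exp (n * s *
      (u ⬝ᵥ (sampleCov (fun i => Y i ω) - Sig0) *ᵥ u))) ∂P ≤
      ENNReal.ofReal (Real.exp (n * (48 * (s / (k / (16 * Real.exp 1 * σ₀ ^ 2))) ^ 2))) := by
  set s₁ := k / (16 * Real.exp 1 * σ₀ ^ 2) with hs₁
  have hs₁0 : 0 < s₁ := by have := Real.exp_pos 1; positivity
  set m := u ⬝ᵥ Sig0 *ᵥ u with hm
  let Z : Fin n → Ω → ℝ := fun i ω => (u ⬝ᵥ Y i ω) ^ 2 - m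
  have hmeasdot : ∀ i, Measurable fun ω => u ⬝ᵥ Y i ω := fun i => by
    have hY := h.measurable i
    simp only [dotProduct]; fun_prop
  have hZ : ∀ i, Integrable (fun ω => Real.exp (s * Z i ω)) P ∧
      mgf (Z i) P s ≤ Real.exp (48 * (s / s₁) ^ 2) := fun i => by
    have := mgf_sq_sub_le (hmeasdot i) hs₁0 (h.lintegral_exp_sq_le hσ₀ hk hc i u hu) hs
    rw [h.integral_sq hσ₀ hk hc i u] at this
    exact this.2
  have hZmeas : ∀ i, Measurable (Z i) := fun i => by
    have := hmeasdot i
    fun_prop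
  have hind : iIndepFun Z P :=
    h.indep.comp (fun _ y => (u ⬝ᵥ y) ^ 2 - m) fun _ => by simp only [dotProduct]; fun_prop
  have hint := hind.integrable_exp_mul_sum (t := s) hZmeas (s := Finset.univ) fun i _ => (hZ i).1
  have hmgf := hind.mgf_sum (t := s) hZmeas Finset.univ
  have hn' : (n : ℝ) ≠ 0 := by positivity
  have e : ∀ ω, n * s * (u ⬝ᵥ (sampleCov (fun i => Y i ω) - Sig0) *ᵥ u) =
      s * (∑ i, Z i) ω := fun ω => by
    rw [Matrix.sub_mulVec, dotProduct_sub, dotProduct_sampleCov_mulVec, Finset.sum_apply]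
    simp only [Z]
    rw [Finset.sum_sub_distrib, ← hm]
    simp; field_simp
  simp_rw [e]
  rw [← ofReal_integral_eq_lintegral_ofReal hint (ae_of_all _ fun ω => Real.exp_nonneg _)]
  refine ENNReal.ofReal_le_ofReal ?_
  change mgf (∑ i, Z i) P s ≤ _
  rw [hmgf, Real.exp_nat_mul]
  calc ∏ i, mgf (Z i) P s ≤ ∏ _i : Fin n, Real.exp (48 * (s / s₁) ^ 2) :=
        Finset.prod_le_prod (fun i _ => mgf_nonneg) fun i _ => (hZ i).2
    _ = _ := by simp

/-- Apart from the factor 2, the left side is the p-th power of 8 exp(a - bM). Once this base is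
below 1 the case p = 1 is the worst, so M can be chosen independently of the dimension. -/
theorem exists_tail_le (a : ℝ) {b : ℝ} (hb : 0 < b) {η : ℝ≥0∞} (hη : 0 < η) :
    ∃ M₀ : ℝ, 0 < M₀ ∧ ∀ M ≥ M₀, ∀ p : ℕ, 1 ≤ p →
      2 * ENNReal.ofReal (Real.exp (a * p)) * 8 ^ p * ENNReal.ofReal (Real.exp (-(b * M * p)))
        ≤ η := by
  have h1 : Tendsto (fun M : ℝ => 8 * Real.exp (a - b * M)) atTop (𝓝 (8 * 0)) := by
    refine Tendsto.const_mul _ (Real.tendsto_exp_atBot.comp ?_)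
    exact tendsto_atBot_add_const_left _ a (tendsto_neg_atTop_atBot.comp
      (Tendsto.const_mul_atTop hb tendsto_id))
  have ht : Tendsto (fun M : ℝ => 2 * ENNReal.ofReal (8 * Real.exp (a - b * M))) atTop (𝓝 0) := by
    have h2 := ENNReal.Tendsto.const_mul (a := 2) (ENNReal.tendsto_ofReal h1) (Or.inr (by simp))
    simpa using h2
  rw [mul_zero] at h1
  have hev := ((ht.eventually (gt_mem_nhds hη)).and
    (h1.eventually (gt_mem_nhds one_pos))).and (eventually_gt_atTop 0)
  obtain ⟨M₀, hM₀⟩ := eventually_atTop.1 hev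
  refine ⟨max M₀ 1, by positivity, fun M hM p hp => ?_⟩
  obtain ⟨⟨h2, h3⟩, -⟩ := hM₀ M ((le_max_left _ _).trans hM)
  refine le_trans (le_of_eq ?_) ((mul_le_mul_right (ENNReal.ofReal_le_ofReal
    (pow_le_of_le_one (by positivity) h3.le (Nat.one_le_iff_ne_zero.1 hp))) 2).trans h2.le)
  have e8 : (8 : ℝ≥0∞) ^ p = ENNReal.ofReal (8 ^ p) := by
    rw [ENNReal.ofReal_pow (by norm_num)]; simp
  rw [e8, mul_assoc, mul_assoc, ← ENNReal.ofReal_mul (by positivity),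
    ← ENNReal.ofReal_mul (by positivity)]
  congr 2
  rw [mul_pow, ← Real.exp_nat_mul, mul_left_comm, ← Real.exp_add]
  congr 2; ring

/-- The sample covariance matrix converges in spectral norm at the rate `√(p / n)`. -/
theorem exists_forall_meas_specNorm_sampleCov_le {σ₀ k : ℝ} (hσ₀ : 0 < σ₀) (hk : 0 < k)
    {η : ℝ≥0∞} (hη : 0 < η) :
    ∃ M₀ : ℝ, 0 < M₀ ∧ ∀ M ≥ M₀, ∀ {Ω : Type*} [MeasurableSpace Ω] {n p : ℕ} (P : Measure Ω)
      [IsProbabilityMeasure P] (Y : Fin n → Ω → Fin p → ℝ) (Sig0 : Matrix (Fin p) (Fin p) ℝ),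
      WellConditioned k Sig0 → TrueModel P Y Sig0 σ₀ → 1 ≤ p → p ≤ n →
      P {ω | M * Real.sqrt ((p : ℝ) / n) ≤ specNorm (sampleCov (fun i => Y i ω) - Sig0)} ≤ η := by
  set s₁ := k / (16 * Real.exp 1 * σ₀ ^ 2) with hs₁
  have hs₁0 : 0 < s₁ := by have := Real.exp_pos 1; positivity
  -- With ρ² = p/n and s = s₁ρ/2, the exponent n · 48 (s/s₁)² is 12p, and τr/4 = (ns)(Mρ)/4 is
  -- (s₁/8)Mp. The condition 2|s| ≤ s₁ amounts to ρ ≤ 1, that is p ≤ n.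
  obtain ⟨M₀, hM₀, hM⟩ := exists_tail_le 12 (b := s₁ / 8) (by positivity) hη
  refine ⟨M₀, hM₀, fun M hMM Ω _ n p P _ Y Sig0 hc h hp hpn => ?_⟩
  have hM0 : 0 < M := hM₀.trans_le hMM
  have hp0 : (0 : ℝ) < p := by exact_mod_cast hp
  have hn : 0 < n := by omega
  have hn0 : (0 : ℝ) < n := by exact_mod_cast hn
  set ρ := Real.sqrt ((p : ℝ) / n) with hρ
  have hρ0 : 0 < ρ := Real.sqrt_pos.2 (by positivity)
  have hρ2 : ρ ^ 2 = p / n := Real.sq_sqrt (by positivity)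
  have hρ1 : ρ ≤ 1 := Real.sqrt_le_one.2 (by
    rw [div_le_one hn0]; exact_mod_cast hpn)
  have key := meas_le_specNorm_le P (fun ω => sampleCov (fun i => Y i ω) - Sig0)
    (fun a b => by
      have hY := h.measurable
      simp only [sampleCov, Matrix.sub_apply, Matrix.smul_apply, Matrix.sum_apply,
        Matrix.vecMulVec_apply]
      fun_prop)
    (fun ω => by
      have h1 := (sampleCov_isSymm fun i => Y i ω).eq
      have h2 : Sig0ᵀ = Sig0 := by
        simpa [Matrix.conjTranspose_eq_transpose_of_trivial] using hc.1.eq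
      rw [Matrix.IsSymm, Matrix.transpose_sub, h1, h2])
    (τ := n * (s₁ / 2 * ρ)) (r := M * ρ) (by positivity) (by positivity)
    (ENNReal.ofReal (Real.exp (12 * p))) (fun u hu s hs => by
      have hs' : |s / n| = s₁ / 2 * ρ := by
        rw [abs_div, hs, abs_of_pos hn0]; field_simp
      have h1 := h.lintegral_exp_sampleCov_le hσ₀ hk hc hn u hu (s / n) (by
        rw [hs', ← hs₁]; nlinarith)
      rw [← hs₁] at h1
      rw [mul_div_cancel₀ _ hn0.ne'] at h1
      refine h1.trans (ENNReal.ofReal_le_ofReal (Real.exp_le_exp.2 (le_of_eq ?_)))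
      rw [div_pow, ← sq_abs (s / n), hs', mul_pow, hρ2]
      field_simp; norm_num)
  refine key.trans (le_trans (le_of_eq ?_) (hM M hMM p hp))
  congr 4
  have : (n : ℝ) * ρ ^ 2 = p := by rw [hρ2]; field_simp
  rw [← this]; ring

/-! ### Integrals of the multivariate normal density. -/

section normal

variable {ι : Type*} [Fintype ι]

theorem lintegral_exp_neg_dotProduct_self_div_two :
    ∫⁻ y : ι → ℝ, ENNReal.ofReal (Real.exp (-(y ⬝ᵥ y) / 2)) =
      ENNReal.ofReal (Real.sqrt ((2 * Real.pi) ^ Fintype.card ι)) := by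
  have hpi : 0 < 2 * Real.pi := by positivity
  have e : ∀ y : ι → ℝ, Real.exp (-(y ⬝ᵥ y) / 2) =
      Real.sqrt ((2 * Real.pi) ^ Fintype.card ι) * ∏ i, gaussianPDFReal 0 1 (y i) := fun y => by
    simp only [gaussianPDFReal]
    rw [Finset.prod_mul_distrib, ← Real.exp_sum]
    simp only [NNReal.coe_one, mul_one, sub_zero, Finset.prod_const, Finset.card_univ]
    have hsqrt : Real.sqrt ((2 * Real.pi) ^ Fintype.card ι) =
        Real.sqrt (2 * Real.pi) ^ Fintype.card ι := by
      rw [Real.sqrt_eq_iff_mul_self_eq (by positivity) (by positivity), ← mul_pow,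
        Real.mul_self_sqrt hpi.le]
    rw [← mul_assoc, inv_pow, hsqrt, mul_inv_cancel₀ (by positivity), one_mul,
      dotProduct, neg_div, Finset.sum_div, ← Finset.sum_neg_distrib]
    congr 1
    exact Finset.sum_congr rfl fun i _ => by ring
  have hint : Integrable fun y : ι → ℝ => ∏ i, gaussianPDFReal 0 1 (y i) :=
    Integrable.fintype_prod fun _ => integrable_gaussianPDFReal 0 1
  simp_rw [e]
  rw [← ofReal_integral_eq_lintegral_ofReal (hint.const_mul _) (ae_of_all _ fun y => ?_),
    integral_const_mul, integral_fintype_prod_volume_eq_prod]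
  · simp [integral_gaussianPDFReal_eq_one]
  · exact mul_nonneg (Real.sqrt_nonneg _)
      (Finset.prod_nonneg fun i _ => gaussianPDFReal_nonneg _ _ _)

variable [DecidableEq ι]

theorem normalPdf_nonneg (m : ι → ℝ) (V : Matrix ι ι ℝ) (x : ι → ℝ) : 0 ≤ normalPdf m V x :=
  div_nonneg (Real.exp_nonneg _) (Real.sqrt_nonneg _)

@[fun_prop]
theorem continuous_normalPdf (m : ι → ℝ) (V : Matrix ι ι ℝ) : Continuous (normalPdf m V) := by
  unfold normalPdf
  simp only [dotProduct, Matrix.mulVec]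
  fun_prop

/-- After a translation, the substitution x = V^{1/2}y reduces this to a product of standard normal
densities. -/
theorem lintegral_normalPdf {V : Matrix ι ι ℝ} (hV : V.PosDef) (m : ι → ℝ) :
    ∫⁻ x, ENNReal.ofReal (normalPdf m V x) = 1 := by
  have hshift : ∫⁻ x, ENNReal.ofReal (normalPdf m V x) =
      ∫⁻ x, ENNReal.ofReal (normalPdf 0 V x) := by
    rw [← lintegral_sub_right_eq_self (fun x => ENNReal.ofReal (normalPdf 0 V x)) m]
    simp [normalPdf]
  rw [hshift]
  set R := CFC.sqrt V with hR
  have hRR : R * R = V := CFC.sqrt_mul_sqrt_self V hV.posSemidef.nonneg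
  have hRsymm : Rᵀ = R := by
    have : R.PosSemidef := Matrix.nonneg_iff_posSemidef.1 (CFC.sqrt_nonneg V)
    simpa [Matrix.conjTranspose_eq_transpose_of_trivial] using this.isHermitian.eq
  have hVdet : V.det = R.det ^ 2 := by rw [← hRR, Matrix.det_mul, sq]
  have hRdet : R.det ≠ 0 := fun h => hV.det_pos.ne' (by rw [hVdet, h]; simp)
  have hRu : IsUnit R.det := isUnit_iff_ne_zero.2 hRdet
  have hmap := Real.map_matrix_volume_pi_eq_smul_volume_pi hRdet
  have hmeas : Measurable fun x => ENNReal.ofReal (normalPdf 0 V x) := by fun_prop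
  have hlin : Measurable (Matrix.toLin' R) :=
    (LinearMap.continuous_of_finiteDimensional (Matrix.toLin' R)).measurable
  have h1 : ∫⁻ y, ENNReal.ofReal (normalPdf 0 V (R *ᵥ y)) =
      ENNReal.ofReal |R.det⁻¹| * ∫⁻ x, ENNReal.ofReal (normalPdf 0 V x) := by
    have := lintegral_map (μ := volume) hmeas hlin
    rw [hmap, lintegral_smul_measure] at this
    simpa using this.symm
  have h2 : ∀ y, normalPdf 0 V (R *ᵥ y) =
      (Real.sqrt ((2 * Real.pi) ^ Fintype.card ι) * |R.det|)⁻¹ * Real.exp (-(y ⬝ᵥ y) / 2) := by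
    intro y
    have : (R *ᵥ y) ⬝ᵥ (V⁻¹ *ᵥ (R *ᵥ y)) = y ⬝ᵥ y := by
      rw [← hRR, Matrix.mul_inv_rev, Matrix.mulVec_mulVec, Matrix.mul_assoc,
        Matrix.nonsing_inv_mul _ hRu, Matrix.mul_one, Matrix.dotProduct_mulVec,
        ← Matrix.mulVec_transpose, Matrix.transpose_nonsing_inv, hRsymm, Matrix.mulVec_mulVec,
        Matrix.nonsing_inv_mul _ hRu, Matrix.one_mulVec]
    rw [normalPdf, sub_zero, this, hVdet, Real.sqrt_mul (by positivity), Real.sqrt_sq_eq_abs,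
      div_eq_inv_mul]
  simp_rw [h2] at h1
  simp_rw [ENNReal.ofReal_mul (inv_nonneg.2 (mul_nonneg (Real.sqrt_nonneg
    ((2 * Real.pi) ^ Fintype.card ι)) (abs_nonneg R.det)))] at h1
  have hdabs : 0 < |R.det| := abs_pos.2 hRdet
  have hsq : 0 < Real.sqrt ((2 * Real.pi) ^ Fintype.card ι) := Real.sqrt_pos.2 (by positivity)
  rw [lintegral_const_mul _ (by simp only [dotProduct]; fun_prop),
    lintegral_exp_neg_dotProduct_self_div_two, ← ENNReal.ofReal_mul (by positivity), mul_inv,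
    mul_right_comm, inv_mul_cancel₀ hsq.ne', one_mul, abs_inv] at h1
  have h3 : ENNReal.ofReal |R.det|⁻¹ ≠ 0 := by simpa using hRdet
  have h4 := ENNReal.eq_div_iff h3 ENNReal.ofReal_ne_top |>.2 h1.symm
  rw [h4, ENNReal.div_self h3 ENNReal.ofReal_ne_top]

/-- Completing the square: tilting N(0, V) by l gives a multiple of N(Vl, V). -/
theorem lintegral_exp_dotProduct_mul_normalPdf {V : Matrix ι ι ℝ} (hV : V.PosDef) (l : ι → ℝ) :
    ∫⁻ x, ENNReal.ofReal (Real.exp (l ⬝ᵥ x) * normalPdf 0 V x) =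
      ENNReal.ofReal (Real.exp (l ⬝ᵥ V *ᵥ l / 2)) := by
  have hVu : IsUnit V.det := isUnit_iff_ne_zero.2 hV.det_pos.ne'
  have hVs : Vᵀ = V := by
    simpa [Matrix.conjTranspose_eq_transpose_of_trivial] using hV.isHermitian.eq
  have hVis : (V⁻¹)ᵀ = V⁻¹ := by rw [Matrix.transpose_nonsing_inv, hVs]
  have e : ∀ x, Real.exp (l ⬝ᵥ x) * normalPdf 0 V x =
      Real.exp (l ⬝ᵥ V *ᵥ l / 2) * normalPdf (V *ᵥ l) V x := fun x => by
    simp only [normalPdf]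
    rw [mul_div, mul_div, ← Real.exp_add, ← Real.exp_add]
    congr 2
    have h1 : V⁻¹ *ᵥ (V *ᵥ l) = l := by
      rw [Matrix.mulVec_mulVec, Matrix.nonsing_inv_mul _ hVu, Matrix.one_mulVec]
    have h2 : (V *ᵥ l) ⬝ᵥ (V⁻¹ *ᵥ x) = l ⬝ᵥ x := by
      rw [Matrix.dotProduct_mulVec, ← Matrix.mulVec_transpose, hVis, h1]
    rw [sub_zero, Matrix.mulVec_sub, h1, sub_dotProduct, dotProduct_sub, dotProduct_sub, h2,
      dotProduct_comm x l, dotProduct_comm (V *ᵥ l) l]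
    ring
  simp_rw [e, ENNReal.ofReal_mul (Real.exp_nonneg _)]
  rw [lintegral_const_mul _ (by fun_prop), lintegral_normalPdf hV, mul_one]

end normal

/-! ### The symmetric matrix-normal law. -/

/-- The coordinates `d` for which `x ↦ x ⬝ᵥ d` is half the trace pairing with `C`. -/
noncomputable def halfTraceVec {p : ℕ} (C : Matrix (Fin p) (Fin p) ℝ) : VechIdx p → ℝ :=
  fun k => C k.1.1 k.1.2 * (if k.1.1 = k.1.2 then 1 / 2 else 1)

/-- `Bmat` spreads an off-diagonal coordinate over two positions with weight 1/2 but keeps a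
diagonal one with weight 1; halving the diagonal in `halfTraceVec` evens this out. -/
theorem Bmat_mulVec_halfTraceVec {p : ℕ} (C : Matrix (Fin p) (Fin p) ℝ) (hC : C.IsSymm) :
    Bmat p *ᵥ halfTraceVec C = (1 / 2 : ℝ) • C.vec := by
  funext ⟨a, b⟩
  simp only [Matrix.mulVec, dotProduct, Pi.smul_apply, Matrix.vec, smul_eq_mul]
  rcases lt_trichotomy a b with h | rfl | h
  · rw [Finset.sum_eq_single ⟨(b, a), h.le⟩]
    · simp [Bmat, halfTraceVec, h.ne, h.ne', mul_comm]
    · rintro ⟨⟨c, d⟩, hcd⟩ - hne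
      have h1 : ¬ (a = d ∧ b = c) := by rintro ⟨rfl, rfl⟩; exact hne rfl
      have h2 : ¬ (a = c ∧ b = d) := by rintro ⟨rfl, rfl⟩; exact absurd hcd (not_le.2 h)
      simp [Bmat, h1, h2]
    · simp
  · rw [Finset.sum_eq_single ⟨(a, a), le_rfl⟩]
    · simp [Bmat, halfTraceVec, mul_comm]
    · rintro ⟨⟨c, d⟩, hcd⟩ - hne
      have h1 : ¬ (a = d ∧ a = c) := by rintro ⟨rfl, rfl⟩; exact hne rfl
      have h2 : ¬ (a = c ∧ a = d) := by rintro ⟨rfl, rfl⟩; exact hne rfl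
      simp [Bmat, h1, h2]
    · simp
  · rw [Finset.sum_eq_single ⟨(a, b), h.le⟩]
    · simp [Bmat, halfTraceVec, h.ne, h.ne', mul_comm, hC.apply b a]
    · rintro ⟨⟨c, d⟩, hcd⟩ - hne
      have h1 : ¬ (a = c ∧ b = d) := by rintro ⟨rfl, rfl⟩; exact hne rfl
      have h2 : ¬ (a = d ∧ b = c) := by rintro ⟨rfl, rfl⟩; exact absurd hcd (not_le.2 h)
      simp [Bmat, h1, h2]
    · simp

theorem vech_dotProduct_halfTraceVec {p : ℕ} (X C : Matrix (Fin p) (Fin p) ℝ) (hX : X.IsSymm)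
    (hC : C.IsSymm) : vech X ⬝ᵥ halfTraceVec C = (X * C).trace / 2 := by
  rw [← Bmat_transpose_mulVec_vec X hX, Matrix.mulVec_transpose, ← Matrix.dotProduct_mulVec,
    Bmat_mulVec_halfTraceVec C hC, dotProduct_smul, Matrix.vec_dotProduct_vec, hX.eq]
  simp; ring

/-- The covariance matrix `2 B_pᵀ (S ⊗ S) B_p`. -/
noncomputable def smnCov {p : ℕ} (S : Matrix (Fin p) (Fin p) ℝ) : Matrix (VechIdx p) (VechIdx p) ℝ :=
  (2 : ℝ) • ((Bmat p)ᵀ * (S ⊗ₖ S) * Bmat p)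

/-- Since (S ⊗ S) vec C = vec(SCS), the choice C = S⁻¹TS⁻¹ solves the linear system with right side
vech T. The inverse covariance is thus applied without being computed. -/
theorem smnCov_mulVec_halfTraceVec {p : ℕ} (S C : Matrix (Fin p) (Fin p) ℝ) (hS : S.IsSymm)
    (hC : C.IsSymm) : smnCov S *ᵥ halfTraceVec C = vech (S * C * S) := by
  have hSCS : (S * C * S).IsSymm := by
    rw [Matrix.IsSymm, Matrix.transpose_mul, Matrix.transpose_mul, hS.eq, hC.eq, Matrix.mul_assoc]
  rw [smnCov, Matrix.smul_mulVec, ← Matrix.mulVec_mulVec, Bmat_mulVec_halfTraceVec C hC,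
    Matrix.mulVec_smul, smul_smul, ← Matrix.mulVec_mulVec, Matrix.kronecker_mulVec_vec, hS.eq,
    Bmat_transpose_mulVec_vec _ hSCS]
  norm_num

theorem smnCov_posDef {p : ℕ} {S : Matrix (Fin p) (Fin p) ℝ} (hS : S.PosDef) :
    (smnCov S).PosDef := by
  have hinj : Function.Injective (Bmat p).mulVec := by
    refine (injective_iff_map_eq_zero (Matrix.mulVecLin (Bmat p))).2 fun x hx => ?_
    -- Doubling the diagonal inverts `halfTraceVec`, so every x has the form to which
    -- `Bmat_mulVec_halfTraceVec` applies.
    let C : Matrix (Fin p) (Fin p) ℝ :=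
      unvech fun k => x k * (if k.1.1 = k.1.2 then 2 else 1)
    have hC : C.IsSymm := unvech_isSymm _
    have hxC : x = halfTraceVec C := by
      funext k
      have := congrFun (vech_unvech fun k : VechIdx p => x k * (if k.1.1 = k.1.2 then 2 else 1)) k
      rw [halfTraceVec]
      change _ = vech C k * _
      rw [this]
      split_ifs <;> ring
    rw [Matrix.mulVecLin_apply, hxC, Bmat_mulVec_halfTraceVec C hC] at hx
    have hC0 : C = 0 := by
      ext i j
      have := congrFun hx (j, i)
      simpa [Matrix.vec] using this
    rw [hxC, hC0]; funext k; simp [halfTraceVec]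
  have h := (hS.kronecker hS).conjTranspose_mul_mul_same hinj
  rw [Matrix.conjTranspose_eq_transpose_of_trivial] at h
  exact h.smul two_pos

theorem isSymm_of_posDef {p : ℕ} {S : Matrix (Fin p) (Fin p) ℝ} (hS : S.PosDef) : S.IsSymm := by
  have := hS.isHermitian.eq
  rwa [Matrix.conjTranspose_eq_transpose_of_trivial] at this

theorem smnCov_inv_mulVec_vech {p : ℕ} {S T : Matrix (Fin p) (Fin p) ℝ} (hS : S.PosDef)
    (hT : T.IsSymm) : (smnCov S)⁻¹ *ᵥ vech T = halfTraceVec (S⁻¹ * T * S⁻¹) := by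
  have hSs := isSymm_of_posDef hS
  have hSu : IsUnit S.det := isUnit_iff_ne_zero.2 hS.det_pos.ne'
  have hVu : IsUnit (smnCov S).det := isUnit_iff_ne_zero.2 (smnCov_posDef hS).det_pos.ne'
  have hC : (S⁻¹ * T * S⁻¹).IsSymm := by
    rw [Matrix.IsSymm, Matrix.transpose_mul, Matrix.transpose_mul, Matrix.transpose_nonsing_inv,
      hSs.eq, hT.eq, Matrix.mul_assoc]
  have h := smnCov_mulVec_halfTraceVec S _ hSs hC
  have e : S * (S⁻¹ * T * S⁻¹) * S = T := by
    rw [Matrix.mul_assoc, Matrix.mul_assoc, Matrix.nonsing_inv_mul _ hSu, Matrix.mul_one,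
      ← Matrix.mul_assoc, Matrix.mul_nonsing_inv _ hSu, Matrix.one_mul]
  rw [e] at h
  rw [← h, Matrix.mulVec_mulVec, Matrix.nonsing_inv_mul _ hVu, Matrix.one_mulVec]

/-- The form vech(T)ᵀV⁻¹vech(T) equals tr(S⁻¹TS⁻¹T)/2, so the Gaussian exponent matches the
quadratic term of the log-likelihood. -/
theorem phi_eq {p : ℕ} {S T : Matrix (Fin p) (Fin p) ℝ} (hS : S.PosDef) (hT : T.IsSymm) :
    phi S T = Real.exp (-(S⁻¹ * T * S⁻¹ * T).trace / 4) /
      Real.sqrt ((2 * Real.pi) ^ Fintype.card (VechIdx p) * (smnCov S).det) := by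
  have hSs := isSymm_of_posDef hS
  have hC : (S⁻¹ * T * S⁻¹).IsSymm := by
    rw [Matrix.IsSymm, Matrix.transpose_mul, Matrix.transpose_mul, Matrix.transpose_nonsing_inv,
      hSs.eq, hT.eq, Matrix.mul_assoc]
  have h0 : vech (0 : Matrix (Fin p) (Fin p) ℝ) = 0 := rfl
  change normalPdf _ (smnCov S) _ = _
  rw [normalPdf, h0, sub_zero, smnCov_inv_mulVec_vech hS hT,
    vech_dotProduct_halfTraceVec _ _ hT hC, Matrix.trace_mul_comm]
  congr 2; ring

theorem phi_unvech {p : ℕ} (S : Matrix (Fin p) (Fin p) ℝ) (x : VechIdx p → ℝ) :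
    phi S (unvech x) = normalPdf 0 (smnCov S) x := by
  unfold phi smnPdf
  rw [vech_unvech]; rfl

theorem lintegral_phi {p : ℕ} {S : Matrix (Fin p) (Fin p) ℝ} (hS : S.PosDef) :
    ∫⁻ x : VechIdx p → ℝ, ENNReal.ofReal (phi S (unvech x)) = 1 := by
  simp_rw [phi_unvech]
  exact lintegral_normalPdf (smnCov_posDef hS) 0

/-- The form uᵀXu is the trace pairing of X with uuᵀ, hence linear in X and centred Gaussian with
variance 2(uᵀSu)². -/
theorem lintegral_exp_mul_phi {p : ℕ} {S : Matrix (Fin p) (Fin p) ℝ} (hS : S.PosDef) (s : ℝ)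
    (u : Fin p → ℝ) :
    ∫⁻ x : VechIdx p → ℝ, ENNReal.ofReal (Real.exp (s * (u ⬝ᵥ unvech x *ᵥ u)) *
      phi S (unvech x)) = ENNReal.ofReal (Real.exp (s ^ 2 * (u ⬝ᵥ S *ᵥ u) ^ 2)) := by
  have hSs := isSymm_of_posDef hS
  set C := Matrix.vecMulVec u u with hC'
  have hC : C.IsSymm := by
    ext i j; simp [C, Matrix.vecMulVec_apply, mul_comm]
  have htr : ∀ X : Matrix (Fin p) (Fin p) ℝ, (X * C).trace = u ⬝ᵥ X *ᵥ u := fun X => by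
    rw [hC', Matrix.mul_vecMulVec, Matrix.trace_vecMulVec, dotProduct_comm]
  have e1 : ∀ x : VechIdx p → ℝ, s * (u ⬝ᵥ unvech x *ᵥ u) = ((2 * s) • halfTraceVec C) ⬝ᵥ x := by
    intro x
    have := vech_dotProduct_halfTraceVec (unvech x) C (unvech_isSymm x) hC
    rw [vech_unvech, htr] at this
    rw [smul_dotProduct, dotProduct_comm (halfTraceVec C), this, smul_eq_mul]; ring
  simp_rw [e1, phi_unvech]
  rw [lintegral_exp_dotProduct_mul_normalPdf (smnCov_posDef hS)]
  congr 2
  have hSCS : (S * C * S).IsSymm := by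
    rw [Matrix.IsSymm, Matrix.transpose_mul, Matrix.transpose_mul, hSs.eq, hC.eq, Matrix.mul_assoc]
  rw [Matrix.mulVec_smul, smnCov_mulVec_halfTraceVec S C hSs hC, smul_dotProduct, dotProduct_smul,
    dotProduct_comm, vech_dotProduct_halfTraceVec _ _ hSCS hC, htr]
  have : u ⬝ᵥ (S * C * S) *ᵥ u = (u ⬝ᵥ S *ᵥ u) ^ 2 := by
    have h1 : C *ᵥ (S *ᵥ u) = (u ⬝ᵥ S *ᵥ u) • u := by
      rw [hC', Matrix.vecMulVec_mulVec]; exact op_smul_eq_smul _ _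
    rw [← Matrix.mulVec_mulVec, ← Matrix.mulVec_mulVec, h1, Matrix.mulVec_smul, dotProduct_smul,
      smul_eq_mul, sq]
  rw [this]; simp only [smul_eq_mul]; ring

/-- The limiting Gaussian law puts little mass outside spectral balls of radius `M √p`. -/
theorem exists_forall_phi_tail_le {K : ℝ} (hK : 0 < K) {η : ℝ≥0∞} (hη : 0 < η) :
    ∃ M₀ : ℝ, 0 < M₀ ∧ ∀ M ≥ M₀, ∀ {p : ℕ} (S : Matrix (Fin p) (Fin p) ℝ), 1 ≤ p → S.PosDef →
      (∀ v, v ⬝ᵥ S *ᵥ v ≤ K * (v ⬝ᵥ v)) →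
      ∫⁻ x in {x : VechIdx p → ℝ | M * Real.sqrt p ≤ specNorm (unvech x)},
        ENNReal.ofReal (phi S (unvech x)) ≤ η := by
  -- With τ = √p and r = M√p, the moment exponent is p(uᵀSu)² ≤ p(4K)² and τr/4 = Mp/4.
  obtain ⟨M₀, hM₀, hM⟩ := exists_tail_le (16 * K ^ 2) (b := 1 / 4) (by norm_num) hη
  refine ⟨M₀, hM₀, fun M hMM p S hp hS hSK => ?_⟩
  have hM0 : 0 < M := hM₀.trans_le hMM
  have hp0 : (0 : ℝ) < p := by exact_mod_cast hp
  have hsp : 0 < Real.sqrt p := Real.sqrt_pos.2 hp0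
  have hss : Real.sqrt p * Real.sqrt p = p := Real.mul_self_sqrt hp0.le
  have hmeas : Measurable fun x : VechIdx p → ℝ => ENNReal.ofReal (phi S (unvech x)) := by
    simp_rw [phi_unvech]; fun_prop
  have hset : MeasurableSet {x : VechIdx p → ℝ | M * Real.sqrt p ≤ specNorm (unvech x)} :=
    measurableSet_le measurable_const (continuous_specNorm.comp continuous_unvech).measurable
  set μ : Measure (VechIdx p → ℝ) :=
    volume.withDensity fun x => ENNReal.ofReal (phi S (unvech x)) with hμ
  have key := meas_le_specNorm_le μ unvech
    (fun i j => ((continuous_apply j).comp ((continuous_apply i).comp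
      continuous_unvech)).measurable) unvech_isSymm
    (τ := Real.sqrt p) (r := M * Real.sqrt p) hsp (by positivity)
    (ENNReal.ofReal (Real.exp (16 * K ^ 2 * p))) (fun u hu s hs => by
      have hm : Measurable fun x : VechIdx p → ℝ =>
          ENNReal.ofReal (Real.exp (s * (u ⬝ᵥ unvech x *ᵥ u))) := by
        have : Continuous fun x : VechIdx p → ℝ => u ⬝ᵥ unvech x *ᵥ u :=
          continuous_const.dotProduct (continuous_unvech.matrix_mulVec continuous_const)
        exact (Real.continuous_exp.comp (continuous_const.mul this)).measurable.ennreal_ofReal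
      rw [hμ, lintegral_withDensity_eq_lintegral_mul _ hmeas hm]
      have := lintegral_exp_mul_phi hS s u
      simp_rw [ENNReal.ofReal_mul (Real.exp_nonneg _)] at this
      simp only [Pi.mul_apply]
      simp_rw [mul_comm (ENNReal.ofReal (phi S _))]
      rw [this]
      refine ENNReal.ofReal_le_ofReal (Real.exp_le_exp.2 ?_)
      have h0 : 0 ≤ u ⬝ᵥ S *ᵥ u := by
        simpa using hS.posSemidef.dotProduct_mulVec_nonneg u
      have h1 : u ⬝ᵥ S *ᵥ u ≤ 4 * K := (hSK u).trans (by nlinarith)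
      have h2 : (u ⬝ᵥ S *ᵥ u) ^ 2 ≤ 16 * K ^ 2 := by nlinarith
      rw [← sq_abs s, hs, sq, hss]
      nlinarith)
  rw [hμ, withDensity_apply _ hset] at key
  refine key.trans (le_trans (le_of_eq ?_) (hM M hMM p hp))
  congr 4
  linear_combination (M / 4) * hss

/-! ### Expansion of the log-likelihood at the sample covariance matrix. -/

/-- The linear terms of log(1 + x) and 1/(1 + x) cancel, as they must at the maximiser. The
third-order remainders of the two series are at most 2|x|³ each. -/
theorem abs_log_one_add_add_inv_sub_le {x : ℝ} (hx : |x| ≤ 1 / 2) :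
    |Real.log (1 + x) + (1 + x)⁻¹ - 1 - x ^ 2 / 2| ≤ 4 * |x| ^ 3 := by
  have h1 := Real.abs_log_sub_add_sum_range_le (x := -x) (by rw [abs_neg]; linarith) 2
  rw [abs_neg, sub_neg_eq_add] at h1
  norm_num [Finset.sum_range_succ] at h1
  have hx' := abs_le.1 hx
  have h2 : |x| ^ 3 / (1 - |x|) ≤ 2 * |x| ^ 3 := by
    rw [div_le_iff₀ (by linarith)]
    nlinarith [pow_nonneg (abs_nonneg x) 3]
  have h3 : |x ^ 3 / (1 + x)| ≤ 2 * |x| ^ 3 := by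
    rw [abs_div, abs_pow, abs_of_pos (by linarith : 0 < 1 + x), div_le_iff₀ (by linarith)]
    nlinarith [pow_nonneg (abs_nonneg x) 3]
  have e : Real.log (1 + x) + (1 + x)⁻¹ - 1 - x ^ 2 / 2 =
      (-x + x ^ 2 / 2 + Real.log (1 + x)) - x ^ 3 / (1 + x) := by
    have : 1 + x ≠ 0 := by linarith
    field_simp; ring
  rw [e]
  exact (abs_sub _ _).trans (by linarith)

/-- Congruence by W multiplies determinants by a common factor and cancels in the trace, so only the
relative eigenvalues `d` remain. -/
theorem logLik_mul_diagonal_mul_transpose {p : ℕ} (n : ℕ) {W : Matrix (Fin p) (Fin p) ℝ}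
    {d : Fin p → ℝ} (hW : IsUnit W.det) (hd : ∀ i, 0 < d i) :
    logLik n (W * Wᵀ) (W * Matrix.diagonal d * Wᵀ) - logLik n (W * Wᵀ) (W * Wᵀ) =
      -(n / 2 : ℝ) * ∑ i, (Real.log (d i) + (d i)⁻¹ - 1) := by
  have hW0 : W.det ≠ 0 := hW.ne_zero
  have hWt : IsUnit (Wᵀ).det := by rwa [Matrix.det_transpose]
  have hdet : (W * Matrix.diagonal d * Wᵀ).det = (W * Wᵀ).det * ∏ i, d i := by
    rw [Matrix.det_mul, Matrix.det_mul, Matrix.det_mul, Matrix.det_diagonal]; ring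
  have hlog : Real.log (W * Matrix.diagonal d * Wᵀ).det =
      Real.log (W * Wᵀ).det + ∑ i, Real.log (d i) := by
    rw [hdet, Real.log_mul, Real.log_prod]
    · exact fun i _ => (hd i).ne'
    · rw [Matrix.det_mul, Matrix.det_transpose]; exact mul_ne_zero hW0 hW0
    · exact Finset.prod_ne_zero_iff.2 fun i _ => (hd i).ne'
  have hDinv : (Matrix.diagonal d)⁻¹ = Matrix.diagonal fun i => (d i)⁻¹ := by
    refine Matrix.inv_eq_right_inv ?_
    rw [Matrix.diagonal_mul_diagonal, ← Matrix.diagonal_one]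
    congr 1; funext i; exact mul_inv_cancel₀ (hd i).ne'
  have htr : ((W * Matrix.diagonal d * Wᵀ)⁻¹ * (W * Wᵀ)).trace = ∑ i, (d i)⁻¹ := by
    have : (W * Matrix.diagonal d * Wᵀ)⁻¹ * (W * Wᵀ) =
        (Wᵀ)⁻¹ * ((Matrix.diagonal d)⁻¹ * (W⁻¹ * W) * Wᵀ) := by
      rw [Matrix.mul_inv_rev, Matrix.mul_inv_rev]; simp only [Matrix.mul_assoc]
    rw [this, Matrix.nonsing_inv_mul _ hW, Matrix.mul_one, Matrix.trace_mul_comm, Matrix.mul_assoc,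
      Matrix.mul_nonsing_inv _ hWt, Matrix.mul_one, hDinv, Matrix.trace_diagonal]
  have htr1 : ((W * Wᵀ)⁻¹ * (W * Wᵀ)).trace = p := by
    rw [Matrix.nonsing_inv_mul, Matrix.trace_one, Fintype.card_fin]
    rw [Matrix.det_mul]; exact hW.mul hWt
  have hsum : ∑ i, (Real.log (d i) + (d i)⁻¹ - 1) =
      ∑ i, Real.log (d i) + ∑ i, (d i)⁻¹ - p := by
    rw [Finset.sum_sub_distrib, Finset.sum_add_distrib]; simp
  rw [logLik, logLik, hlog, htr, htr1, hsum]; ring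

/-- The vector is W⁻ᵀeᵢ. Because it serves every `d` at once, comparing two forms at it compares
their relative eigenvalues. -/
theorem exists_dotProduct_mulVec_eq_diagonal {p : ℕ} {W : Matrix (Fin p) (Fin p) ℝ}
    (hW : IsUnit W.det) (i : Fin p) :
    ∃ w : Fin p → ℝ, w ≠ 0 ∧ ∀ d : Fin p → ℝ, w ⬝ᵥ (W * Matrix.diagonal d * Wᵀ) *ᵥ w = d i := by
  have hWt : IsUnit (Wᵀ).det := by rwa [Matrix.det_transpose]
  have hw : Wᵀ *ᵥ ((Wᵀ)⁻¹ *ᵥ Pi.single i 1) = Pi.single i 1 := by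
    rw [Matrix.mulVec_mulVec, Matrix.mul_nonsing_inv _ hWt, Matrix.one_mulVec]
  refine ⟨(Wᵀ)⁻¹ *ᵥ Pi.single i 1, fun h => ?_, fun d => ?_⟩
  · rw [h, Matrix.mulVec_zero] at hw
    have := congrFun hw i
    simp at this
  · rw [← Matrix.mulVec_mulVec, hw, ← Matrix.mulVec_mulVec, Matrix.dotProduct_mulVec,
      ← Matrix.mulVec_transpose, hw]
    simp

/-- The Gaussian likelihood is maximal at the sample covariance matrix. -/
theorem logLik_le_self {p : ℕ} (n : ℕ) {S Sig : Matrix (Fin p) (Fin p) ℝ} (hS : S.PosDef)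
    (hSig : Sig.PosDef) : logLik n S Sig ≤ logLik n S S := by
  obtain ⟨W, d, hW, rfl, rfl⟩ := exists_congr_diagonal hS (isSymm_of_posDef hSig)
  have hd : ∀ i, 0 < d i := fun i => by
    obtain ⟨w, hw, h⟩ := exists_dotProduct_mulVec_eq_diagonal hW i
    rw [← h d]
    simpa using hSig.dotProduct_mulVec_pos hw
  have h := logLik_mul_diagonal_mul_transpose n hW hd
  have h2 : 0 ≤ ∑ i, (Real.log (d i) + (d i)⁻¹ - 1) := Finset.sum_nonneg fun i _ => by
    have := Real.one_sub_inv_le_log_of_pos (hd i)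
    linarith
  have h3 : (0 : ℝ) ≤ n := n.cast_nonneg
  nlinarith

theorem posDef_add_smul {p : ℕ} {S T : Matrix (Fin p) (Fin p) ℝ} (hS : S.PosDef) (hT : T.IsSymm)
    {κ c : ℝ} (hSκ : ∀ v, κ * (v ⬝ᵥ v) ≤ v ⬝ᵥ S *ᵥ v) (h : |c| * specNorm T < κ) :
    (S + c • T).PosDef := by
  refine Matrix.PosDef.of_dotProduct_mulVec_pos ?_ fun v hv => ?_
  · rw [Matrix.IsHermitian, Matrix.conjTranspose_eq_transpose_of_trivial, Matrix.transpose_add,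
      Matrix.transpose_smul, hT.eq, (isSymm_of_posDef hS).eq]
  · have hv0 : 0 < v ⬝ᵥ v := by
      have h0 : 0 ≤ v ⬝ᵥ v := by
        rw [dotProduct]; exact Finset.sum_nonneg fun i _ => mul_self_nonneg _
      exact lt_of_le_of_ne h0 fun h => hv (dotProduct_self_eq_zero.1 h.symm)
    rw [star_trivial, Matrix.add_mulVec, dotProduct_add, Matrix.smul_mulVec, dotProduct_smul,
      smul_eq_mul]
    have h1 := hSκ v
    have h2 := abs_dotProduct_mulVec_le T v
    have h3 : |c * (v ⬝ᵥ T *ᵥ v)| ≤ |c| * specNorm T * (v ⬝ᵥ v) := by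
      rw [abs_mul, mul_assoc]; gcongr
    have h4 := neg_abs_le (c * (v ⬝ᵥ T *ᵥ v))
    nlinarith

/-- Uniform quadratic expansion of the log-likelihood around the sample covariance matrix. -/
theorem abs_logLik_sub_add_trace_le {p n : ℕ} {S T : Matrix (Fin p) (Fin p) ℝ} (hS : S.PosDef)
    (hT : T.IsSymm) {κ R : ℝ} (hκ : 0 < κ) (hSκ : ∀ v, κ * (v ⬝ᵥ v) ≤ v ⬝ᵥ S *ᵥ v) (hn : 0 < n)
    (hTR : specNorm T ≤ R) (hR : R / (κ * Real.sqrt n) ≤ 1 / 2) :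
    |logLik n S (S + (1 / Real.sqrt n) • T) - logLik n S S + (S⁻¹ * T * S⁻¹ * T).trace / 4| ≤
      2 * n * p * (R / (κ * Real.sqrt n)) ^ 3 := by
  have hn0 : (0 : ℝ) < n := by exact_mod_cast hn
  have hsn : 0 < Real.sqrt n := Real.sqrt_pos.2 hn0
  have hss : Real.sqrt n ^ 2 = n := Real.sq_sqrt hn0.le
  obtain ⟨W, l, hW, hSW, hTW⟩ := exists_congr_diagonal hS hT
  have hWt : IsUnit (Wᵀ).det := by rwa [Matrix.det_transpose]
  -- At the vector w with wᵀTw = `l i` and wᵀSw = 1, the lower bound on S gives wᵀw ≤ 1/κ.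
  have hl : ∀ i, |l i / Real.sqrt n| ≤ R / (κ * Real.sqrt n) := fun i => by
    obtain ⟨w, hw, h⟩ := exists_dotProduct_mulVec_eq_diagonal hW i
    have h1 := h l
    have h2 := h 1
    rw [← hTW] at h1
    have : Matrix.diagonal (1 : Fin p → ℝ) = 1 := Matrix.diagonal_one
    rw [this, Matrix.mul_one, ← hSW] at h2
    have h3 := abs_dotProduct_mulVec_le T w
    have h4 := hSκ w
    have h5 : 0 ≤ w ⬝ᵥ w := by
      rw [dotProduct]; exact Finset.sum_nonneg fun i _ => mul_self_nonneg _
    rw [h2] at h4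
    rw [h1] at h3
    rw [abs_div, abs_of_pos hsn, ← div_div]
    gcongr
    rw [le_div_iff₀ hκ]
    have h6 : |l i| ≤ R * (w ⬝ᵥ w) := h3.trans (by gcongr)
    have hR0 : 0 ≤ R := (specNorm_nonneg T).trans hTR
    simp only [Pi.one_apply] at h4
    nlinarith
  have hd : ∀ i, 0 < 1 + l i / Real.sqrt n := fun i => by
    have := neg_abs_le (l i / Real.sqrt n)
    have := (hl i).trans hR
    linarith
  have hsum : S + (1 / Real.sqrt n) • T =
      W * Matrix.diagonal (fun i => 1 + l i / Real.sqrt n) * Wᵀ := by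
    have : Matrix.diagonal (fun i => 1 + l i / Real.sqrt n) =
        1 + (1 / Real.sqrt n) • Matrix.diagonal l := by
      rw [← Matrix.diagonal_one, ← Matrix.diagonal_smul, Matrix.diagonal_add]
      congr 1; funext i; simp [div_eq_inv_mul]
    rw [this, Matrix.mul_add, Matrix.add_mul, Matrix.mul_one, ← hSW, Matrix.mul_smul,
      Matrix.smul_mul, ← hTW]
  have htr : (S⁻¹ * T * S⁻¹ * T).trace = ∑ i, l i ^ 2 := by
    have h1 : S⁻¹ * T = (Wᵀ)⁻¹ * (Matrix.diagonal l * Wᵀ) := by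
      rw [hSW, hTW, Matrix.mul_inv_rev]
      have : (Wᵀ)⁻¹ * W⁻¹ * (W * Matrix.diagonal l * Wᵀ) =
        (Wᵀ)⁻¹ * ((W⁻¹ * W) * Matrix.diagonal l * Wᵀ) := by simp only [Matrix.mul_assoc]
      rw [this, Matrix.nonsing_inv_mul _ hW, Matrix.one_mul]
    have h2 : S⁻¹ * T * S⁻¹ * T =
        (Wᵀ)⁻¹ * (Matrix.diagonal l * (Wᵀ * (Wᵀ)⁻¹) * Matrix.diagonal l * Wᵀ) := by
      rw [Matrix.mul_assoc (S⁻¹ * T), h1]; simp only [Matrix.mul_assoc]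
    rw [h2, Matrix.mul_nonsing_inv _ hWt, Matrix.mul_one, Matrix.trace_mul_comm, Matrix.mul_assoc,
      Matrix.mul_nonsing_inv _ hWt, Matrix.mul_one, Matrix.diagonal_mul_diagonal,
      Matrix.trace_diagonal]
    exact Finset.sum_congr rfl fun i _ => (sq _).symm
  rw [hsum, htr]
  have hlik := logLik_mul_diagonal_mul_transpose n hW hd
  rw [← hSW] at hlik
  rw [hlik]
  have e : -(n / 2 : ℝ) * ∑ i, (Real.log (1 + l i / Real.sqrt n) + (1 + l i / Real.sqrt n)⁻¹ - 1) +
      (∑ i, l i ^ 2) / 4 = -(n / 2 : ℝ) * ∑ i, (Real.log (1 + l i / Real.sqrt n) +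
        (1 + l i / Real.sqrt n)⁻¹ - 1 - (l i / Real.sqrt n) ^ 2 / 2) := by
    rw [Finset.sum_sub_distrib (g := fun i => (l i / Real.sqrt n) ^ 2 / 2), mul_sub,
      ← Finset.sum_div]
    simp_rw [div_pow, hss]
    rw [← Finset.sum_div]
    field_simp
    ring
  rw [e, abs_mul, abs_neg, abs_of_pos (by positivity : (0 : ℝ) < n / 2)]
  have hterm : ∀ i ∈ Finset.univ, |Real.log (1 + l i / Real.sqrt n) +
        (1 + l i / Real.sqrt n)⁻¹ - 1 - (l i / Real.sqrt n) ^ 2 / 2| ≤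
        4 * (R / (κ * Real.sqrt n)) ^ 3 := fun i _ => by
    refine (abs_log_one_add_add_inv_sub_le ((hl i).trans hR)).trans ?_
    have := hl i
    gcongr
  calc _ ≤ (n / 2 : ℝ) * ∑ _i : Fin p, 4 * (R / (κ * Real.sqrt n)) ^ 3 := by
        gcongr
        exact (Finset.abs_sum_le_sum_abs _ _).trans (Finset.sum_le_sum hterm)
    _ = _ := by simp; ring

/-! ### L¹ comparison of nearly proportional densities. -/

/-- If an unnormalised density `h` is nearly proportional to a probability density `φ` on a set `G`
carrying nearly all the mass of both, then its normalisation is close to `φ` in `L¹`. -/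
theorem lintegral_abs_div_integral_sub_le {α : Type*} [MeasurableSpace α] {μ : Measure α}
    {B G : Set α} (hB : MeasurableSet B) (hG : MeasurableSet G) (hGB : G ⊆ B) {h φ : α → ℝ}
    (hm : Measurable h) (hφm : Measurable φ) (h0 : ∀ x, 0 ≤ h x) (hφ0 : ∀ x, 0 ≤ φ x)
    (hφ1 : ∫⁻ x, ENNReal.ofReal (φ x) ∂μ = 1) {c δ : ℝ} (hc : 0 < c) (hδ : 0 < δ) (hδ' : δ ≤ 1 / 4)
    (hlow : ∀ x ∈ G, (1 - δ) * (c * φ x) ≤ h x) (hup : ∀ x ∈ G, h x ≤ (1 + δ) * (c * φ x))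
    (hfin : ∫⁻ x in B, ENNReal.ofReal (h x) ∂μ ≠ ∞)
    (hout : ∫⁻ x in B \ G, ENNReal.ofReal (h x) ∂μ ≤
      ENNReal.ofReal δ * ∫⁻ x in B, ENNReal.ofReal (h x) ∂μ)
    (hφout : ∫⁻ x in Gᶜ, ENNReal.ofReal (φ x) ∂μ ≤ ENNReal.ofReal δ) :
    ∫⁻ x in B, ENNReal.ofReal |h x / (∫ x in B, h x ∂μ) - φ x| ∂μ ≤ ENNReal.ofReal (8 * δ) := by
  have hhB : IntegrableOn h B μ := ⟨hm.aestronglyMeasurable, by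
    rw [hasFiniteIntegral_iff_ofReal (ae_of_all _ h0)]; exact hfin.lt_top⟩
  have hφi : Integrable φ μ := ⟨hφm.aestronglyMeasurable, by
    rw [hasFiniteIntegral_iff_ofReal (ae_of_all _ hφ0), hφ1]; simp⟩
  set H := ∫ x in B, h x ∂μ with hH
  have hHeq : ∫⁻ x in B, ENNReal.ofReal (h x) ∂μ = ENNReal.ofReal H :=
    (ofReal_integral_eq_lintegral_ofReal hhB (ae_of_all _ h0)).symm
  have hH0 : 0 ≤ H := integral_nonneg h0
  have hφint : ∫ x, φ x ∂μ = 1 := by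
    rw [integral_eq_lintegral_of_nonneg_ae (ae_of_all _ hφ0) hφm.aestronglyMeasurable, hφ1]; rfl
  have hhG : IntegrableOn h G μ := hhB.mono_set hGB
  have hhBG : IntegrableOn h (B \ G) μ := hhB.mono_set Set.sdiff_subset
  have hsplit : H = ∫ x in G, h x ∂μ + ∫ x in B \ G, h x ∂μ := by
    rw [hH, ← setIntegral_union Set.disjoint_sdiff_right (hB.diff hG) hhG hhBG,
      Set.union_sdiff_cancel hGB]
  have hBGle : ∫ x in B \ G, h x ∂μ ≤ δ * H := by
    rw [integral_eq_lintegral_of_nonneg_ae (ae_of_all _ h0) hm.aestronglyMeasurable]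
    refine ENNReal.toReal_le_of_le_ofReal (by positivity) ?_
    rwa [ENNReal.ofReal_mul hδ.le, ← hHeq]
  have hBG0 : 0 ≤ ∫ x in B \ G, h x ∂μ := integral_nonneg h0
  set g := ∫ x in G, φ x ∂μ with hg
  have hg1 : g ≤ 1 := by
    rw [← hφint]; exact setIntegral_le_integral hφi (ae_of_all _ hφ0)
  have hgl : 1 - δ ≤ g := by
    have h1 : g + ∫ x in Gᶜ, φ x ∂μ = 1 := by rw [hg, integral_add_compl hG hφi, hφint]
    have h2 : ∫ x in Gᶜ, φ x ∂μ ≤ δ := by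
      rw [integral_eq_lintegral_of_nonneg_ae (ae_of_all _ hφ0) hφm.aestronglyMeasurable]
      exact ENNReal.toReal_le_of_le_ofReal hδ.le hφout
    linarith
  have hGlow : (1 - δ) * (c * g) ≤ ∫ x in G, h x ∂μ := by
    rw [hg, ← integral_const_mul, ← integral_const_mul]
    exact setIntegral_mono_on ((hφi.integrableOn.const_mul _).const_mul _) hhG hG hlow
  have hGup : ∫ x in G, h x ∂μ ≤ (1 + δ) * (c * g) := by
    rw [hg, ← integral_const_mul, ← integral_const_mul]
    exact setIntegral_mono_on hhG ((hφi.integrableOn.const_mul _).const_mul _) hG hup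
  have hHlow : (1 - δ) * (1 - δ) * c ≤ H := by
    have : (1 - δ) * (c * (1 - δ)) ≤ (1 - δ) * (c * g) := by
      have : 0 ≤ 1 - δ := by linarith
      gcongr
    linarith
  have hHup : (1 - δ) * H ≤ (1 + δ) * c := by
    have : (1 + δ) * (c * g) ≤ (1 + δ) * (c * 1) := by gcongr
    linarith
  have hHpos : 0 < H := lt_of_lt_of_le (by
    have : 0 < 1 - δ := by linarith
    positivity) hHlow
  -- The normaliser H is compared with c through (1 - δ)²c ≤ H and (1 - δ)H ≤ (1 + δ)c.
  have ha1 : c / H ≤ 1 + 4 * δ := by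
    rw [div_le_iff₀ hHpos]
    have h1 : 1 ≤ (1 + 4 * δ) * ((1 - δ) * (1 - δ)) := by nlinarith [mul_pos hδ hδ]
    calc c ≤ (1 + 4 * δ) * ((1 - δ) * (1 - δ)) * c := le_mul_of_one_le_left hc.le h1
      _ = (1 + 4 * δ) * ((1 - δ) * (1 - δ) * c) := by ring
      _ ≤ _ := by gcongr
  have ha2 : 1 - 2 * δ ≤ c / H := by
    rw [le_div_iff₀ hHpos]
    have h1 : (1 - 2 * δ) * (1 + δ) ≤ 1 - δ := by nlinarith
    nlinarith
  -- The upper bound is (1 + δ)(1 + 4δ) ≤ 1 + 6δ, which holds exactly because 0 < δ ≤ 1/4.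
  have hpt : ∀ x ∈ G, |h x / H - φ x| ≤ 6 * δ * φ x := fun x hx => by
    have e1 : h x / H ≤ (1 + δ) * (c / H) * φ x := by
      rw [div_le_iff₀ hHpos]
      refine (hup x hx).trans (le_of_eq ?_); field_simp
    have e2 : (1 - δ) * (c / H) * φ x ≤ h x / H := by
      rw [le_div_iff₀ hHpos]
      refine (le_of_eq ?_).trans (hlow x hx); field_simp
    have e3 : (1 + δ) * (c / H) * φ x ≤ (1 + 6 * δ) * φ x := by
      refine mul_le_mul_of_nonneg_right ?_ (hφ0 x); nlinarith
    have e4 : (1 - 6 * δ) * φ x ≤ (1 - δ) * (c / H) * φ x := by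
      refine mul_le_mul_of_nonneg_right ?_ (hφ0 x); nlinarith
    rw [abs_le]; constructor <;> nlinarith
  have hpart1 : ∫⁻ x in G, ENNReal.ofReal |h x / H - φ x| ∂μ ≤ ENNReal.ofReal (6 * δ) :=
    calc _ ≤ ∫⁻ x in G, ENNReal.ofReal (6 * δ) * ENNReal.ofReal (φ x) ∂μ :=
          setLIntegral_mono' hG fun x hx => by
            rw [← ENNReal.ofReal_mul (by positivity)]
            exact ENNReal.ofReal_le_ofReal (hpt x hx)
      _ = ENNReal.ofReal (6 * δ) * ∫⁻ x in G, ENNReal.ofReal (φ x) ∂μ :=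
          lintegral_const_mul _ (by fun_prop)
      _ ≤ ENNReal.ofReal (6 * δ) * 1 := by
          gcongr; rw [← hφ1]; exact setLIntegral_le_lintegral _ _
      _ = _ := mul_one _
  -- Off G nothing cancels: each of the two densities contributes its mass, at most δ.
  have hpart2 : ∫⁻ x in B \ G, ENNReal.ofReal |h x / H - φ x| ∂μ ≤ ENNReal.ofReal (2 * δ) :=
    calc _ ≤ ∫⁻ x in B \ G, (ENNReal.ofReal H⁻¹ * ENNReal.ofReal (h x) +
            ENNReal.ofReal (φ x)) ∂μ :=
          lintegral_mono fun x => by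
            rw [← ENNReal.ofReal_mul (by positivity), ← ENNReal.ofReal_add
              (mul_nonneg (by positivity) (h0 x)) (hφ0 x)]
            refine ENNReal.ofReal_le_ofReal ((abs_sub _ _).trans (le_of_eq ?_))
            rw [abs_of_nonneg (div_nonneg (h0 x) hH0), abs_of_nonneg (hφ0 x), div_eq_inv_mul]
      _ = ENNReal.ofReal H⁻¹ * ∫⁻ x in B \ G, ENNReal.ofReal (h x) ∂μ +
            ∫⁻ x in B \ G, ENNReal.ofReal (φ x) ∂μ := by
          rw [lintegral_add_left (by fun_prop), lintegral_const_mul _ (by fun_prop)]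
      _ ≤ ENNReal.ofReal H⁻¹ * (ENNReal.ofReal δ * ENNReal.ofReal H) + ENNReal.ofReal δ := by
          rw [hHeq] at hout
          gcongr
          exact (lintegral_mono_set fun x hx => hx.2).trans hφout
      _ = ENNReal.ofReal (2 * δ) := by
          rw [← ENNReal.ofReal_mul hδ.le, ← ENNReal.ofReal_mul (by positivity),
            ← ENNReal.ofReal_add (by positivity) hδ.le]
          congr 1; field_simp; norm_num
  calc ∫⁻ x in B, ENNReal.ofReal |h x / H - φ x| ∂μ
      = ∫⁻ x in G, ENNReal.ofReal |h x / H - φ x| ∂μ +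
          ∫⁻ x in B \ G, ENNReal.ofReal |h x / H - φ x| ∂μ := by
        rw [← lintegral_union (hB.diff hG) Set.disjoint_sdiff_right, Set.union_sdiff_cancel hGB]
    _ ≤ ENNReal.ofReal (6 * δ) + ENNReal.ofReal (2 * δ) := add_le_add hpart1 hpart2
    _ = _ := by rw [← ENNReal.ofReal_add (by positivity) (by positivity)]; congr 1; ring

/-! ### Measurability, and the passage from Σ to T. -/

/-- The cone is a closed set, an intersection of closed half-spaces over all vectors, cut by the
open condition of nonzero determinant. -/
theorem measurableSet_posDefVech {p : ℕ} : MeasurableSet (posDefVech p) := by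
  have h : posDefVech p = (⋂ v : Fin p → ℝ, {x : VechIdx p → ℝ | 0 ≤ v ⬝ᵥ unvech x *ᵥ v}) ∩
      {x | (unvech x).det ≠ 0} := by
    ext x
    have hh : (unvech x).IsHermitian := by
      rw [Matrix.IsHermitian, Matrix.conjTranspose_eq_transpose_of_trivial]; exact unvech_isSymm x
    simp only [posDefVech, Set.mem_ofPred_eq, Set.mem_inter_iff, Set.mem_iInter]
    constructor
    · intro hx
      exact ⟨fun v => by simpa using hx.posSemidef.dotProduct_mulVec_nonneg v, hx.det_pos.ne'⟩
    · rintro ⟨h1, h2⟩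
      have hps : (unvech x).PosSemidef :=
        Matrix.PosSemidef.of_dotProduct_mulVec_nonneg hh fun v => by simpa using h1 v
      exact hps.posDef_iff_det_ne_zero.2 h2
  rw [h]
  refine MeasurableSet.inter (isClosed_iInter fun v => ?_).measurableSet ?_
  · exact isClosed_le continuous_const
      (continuous_const.dotProduct (continuous_unvech.matrix_mulVec continuous_const))
  · exact (isOpen_ne_fun continuous_unvech.matrix_det continuous_const).measurableSet

theorem measurable_logLik_unvech {p : ℕ} (n : ℕ) (S : Matrix (Fin p) (Fin p) ℝ) :
    Measurable fun x : VechIdx p → ℝ => logLik n S (unvech x) := by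
  have hdet : Measurable fun x : VechIdx p → ℝ => (unvech x).det :=
    continuous_unvech.matrix_det.measurable
  have htr : Measurable fun x : VechIdx p → ℝ => ((unvech x)⁻¹ * S).trace := by
    -- Through the adjugate the expression is a polynomial divided by the determinant, hence
    -- measurable also across singular matrices.
    have e : ∀ x : VechIdx p → ℝ, ((unvech x)⁻¹ * S).trace =
        (unvech x).det⁻¹ * ((unvech x).adjugate * S).trace := fun x => by
      rw [Matrix.inv_def, Ring.inverse_eq_inv', Matrix.smul_mul, Matrix.trace_smul, smul_eq_mul]
    simp_rw [e]
    exact hdet.inv.mul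
      (continuous_unvech.matrix_adjugate.matrix_mul continuous_const).matrix_trace.measurable
  unfold logLik
  fun_prop

theorem lintegral_comp_add_smul {ι : Type*} [Fintype ι] {F : (ι → ℝ) → ℝ≥0∞} (hF : Measurable F)
    (v : ι → ℝ) {c : ℝ} (hc : c ≠ 0) :
    ∫⁻ x, F (v + c • x) = ENNReal.ofReal |(c ^ Fintype.card ι)⁻¹| * ∫⁻ x, F x := by
  have h1 := Measure.map_addHaar_smul (volume : Measure (ι → ℝ)) hc
  have h2 := lintegral_map (μ := volume) (hF.comp (measurable_const_add v))
    (measurable_const_smul c)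
  rw [h1, lintegral_smul_measure] at h2
  simp only [Function.comp_def, Module.finrank_fintype_fun_eq_card] at h2
  rw [← h2, lintegral_add_left_eq_self F v, smul_eq_mul]

theorem setBVech_eq_preimage {p n : ℕ} {S : Matrix (Fin p) (Fin p) ℝ} (hS : S.IsSymm) :
    setBVech n S = (fun x => vech S + (1 / Real.sqrt n) • x) ⁻¹' posDefVech p := by
  ext x
  simp only [setBVech, setB, posDefVech, Set.mem_ofPred_eq, Set.mem_preimage, unvech_add,
    unvech_smul, unvech_vech S hS]

theorem measurable_add_smul {p : ℕ} (v : VechIdx p → ℝ) (c : ℝ) :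
    Measurable fun x : VechIdx p → ℝ => v + c • x := by fun_prop

theorem measurableSet_setBVech {p n : ℕ} {S : Matrix (Fin p) (Fin p) ℝ} (hS : S.IsSymm) :
    MeasurableSet (setBVech n S) := by
  rw [setBVech_eq_preimage hS]
  exact measurable_add_smul _ _ measurableSet_posDefVech

theorem measurable_likRatio_mul {p n : ℕ} {S : Matrix (Fin p) (Fin p) ℝ} (hS : S.IsSymm)
    {f : Matrix (Fin p) (Fin p) ℝ → ℝ} (hf : IsPriorDensity f) :
    Measurable fun x : VechIdx p → ℝ =>
      likRatio n S (unvech x) * f (S + (1 / Real.sqrt n) • unvech x) := by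
  have e : ∀ x : VechIdx p → ℝ, S + (1 / Real.sqrt n) • unvech x =
      unvech (vech S + (1 / Real.sqrt n) • x) := fun x => by
    rw [unvech_add, unvech_smul, unvech_vech S hS]
  have h1 : Measurable fun x : VechIdx p → ℝ =>
      logLik n S (unvech (vech S + (1 / Real.sqrt n) • x)) :=
    (measurable_logLik_unvech n S).comp (measurable_add_smul _ _)
  have h2 : Measurable fun x : VechIdx p → ℝ => f (unvech (vech S + (1 / Real.sqrt n) • x)) :=
    hf.measurable.comp (measurable_add_smul _ _)
  unfold likRatio
  simp_rw [e]
  refine Measurable.mul ?_ h2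
  exact Measurable.ite (measurableSet_setBVech hS) (by fun_prop) measurable_const

/-- Change of variables Σ = S + T/√n. The constant and the Jacobian do not depend on A, so they drop
out of ratios, and posterior probabilities of Σ become statements about the unnormalised density of
T. -/
theorem setLIntegral_likRatio_mul {p n : ℕ} (hn : 0 < n) {S : Matrix (Fin p) (Fin p) ℝ}
    (hS : S.IsSymm) {f : Matrix (Fin p) (Fin p) ℝ → ℝ} (hf : IsPriorDensity f)
    {A : Set (VechIdx p → ℝ)} (hA : MeasurableSet A) :
    ∫⁻ x in (fun x => vech S + (1 / Real.sqrt n) • x) ⁻¹' A,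
      ENNReal.ofReal (likRatio n S (unvech x) * f (S + (1 / Real.sqrt n) • unvech x)) =
      ENNReal.ofReal (Real.exp (-logLik n S S)) *
        ENNReal.ofReal |((1 / Real.sqrt n) ^ Fintype.card (VechIdx p))⁻¹| *
        unnormPosterior f n S A := by
  classical
  have hc : 1 / Real.sqrt n ≠ 0 := by
    have : (0 : ℝ) < n := by exact_mod_cast hn
    have := Real.sqrt_pos.2 this
    positivity
  let U : (VechIdx p → ℝ) → ℝ≥0∞ := fun x =>
    ENNReal.ofReal (Real.exp (logLik n S (unvech x)) * f (unvech x))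
  have hU : Measurable U :=
    ((measurable_logLik_unvech n S).exp.mul hf.measurable).ennreal_ofReal
  let F : (VechIdx p → ℝ) → ℝ≥0∞ := A.indicator ((posDefVech p).indicator U)
  have hF : Measurable F := (hU.indicator measurableSet_posDefVech).indicator hA
  have h1 : unnormPosterior f n S A = ∫⁻ x, F x := by
    rw [unnormPosterior, withDensity_apply _ hA, lintegral_indicator hA,
      setLIntegral_indicator measurableSet_posDefVech, Measure.restrict_restrict hA,
      Set.inter_comm]
  have hF' : Measurable fun x => F (vech S + (1 / Real.sqrt n) • x) :=
    hF.comp (measurable_add_smul _ _)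
  rw [h1, mul_assoc, ← lintegral_comp_add_smul hF (vech S) hc, ← lintegral_const_mul _ hF',
    ← lintegral_indicator (measurable_add_smul _ _ hA)]
  refine lintegral_congr fun x => ?_
  have e : S + (1 / Real.sqrt n) • unvech x = unvech (vech S + (1 / Real.sqrt n) • x) := by
    rw [unvech_add, unvech_smul, unvech_vech S hS]
  simp only [F, Set.indicator_apply, Set.mem_preimage]
  by_cases hxA : vech S + (1 / Real.sqrt n) • x ∈ A
  · by_cases hxP : vech S + (1 / Real.sqrt n) • x ∈ posDefVech p
    · have hB : unvech x ∈ setB n S := by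
        rw [setB, Set.mem_ofPred_eq, e]; exact hxP
      rw [if_pos hxA, if_pos hxA, if_pos hxP, likRatio, if_pos hB,
        ← ENNReal.ofReal_mul (Real.exp_nonneg _), e, sub_eq_neg_add, Real.exp_add, mul_assoc]
    · have hB : unvech x ∉ setB n S := by
        rw [setB, Set.mem_ofPred_eq, e]; exact hxP
      rw [if_pos hxA, if_pos hxA, if_neg hxP, likRatio, if_neg hB]; simp
  · rw [if_neg hxA, if_neg hxA, mul_zero]

/-- The likelihood is bounded by its value at S and the prior has total mass one. -/
theorem unnormPosterior_univ_ne_top {p : ℕ} (n : ℕ) {S : Matrix (Fin p) (Fin p) ℝ} (hS : S.PosDef)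
    {f : Matrix (Fin p) (Fin p) ℝ → ℝ} (hf : IsPriorDensity f) :
    unnormPosterior f n S Set.univ ≠ ∞ := by
  rw [unnormPosterior, withDensity_apply _ MeasurableSet.univ, Measure.restrict_univ]
  refine ne_of_lt ?_
  calc _ ≤ ∫⁻ x in posDefVech p, ENNReal.ofReal (Real.exp (logLik n S S)) *
        ENNReal.ofReal (f (unvech x)) :=
        setLIntegral_mono' measurableSet_posDefVech fun x hx => by
          rw [← ENNReal.ofReal_mul (Real.exp_nonneg _)]
          refine ENNReal.ofReal_le_ofReal (mul_le_mul_of_nonneg_right ?_ (hf.nonneg _))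
          exact Real.exp_le_exp.2 (logLik_le_self n hS hx)
    _ ≤ ∫⁻ x, ENNReal.ofReal (Real.exp (logLik n S S)) * ENNReal.ofReal (f (unvech x)) :=
        setLIntegral_le_lintegral _ _
    _ = ENNReal.ofReal (Real.exp (logLik n S S)) := by
        rw [lintegral_const_mul _ hf.measurable.ennreal_ofReal, hf.lintegral_eq_one, mul_one]
    _ < ∞ := ENNReal.ofReal_lt_top

theorem unnormPosterior_posDefVech {p : ℕ} (n : ℕ) (S : Matrix (Fin p) (Fin p) ℝ)
    (f : Matrix (Fin p) (Fin p) ℝ → ℝ) :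
    unnormPosterior f n S (posDefVech p) = unnormPosterior f n S Set.univ := by
  rw [unnormPosterior, withDensity_apply _ measurableSet_posDefVech,
    withDensity_apply _ MeasurableSet.univ, Measure.restrict_univ,
    Measure.restrict_restrict measurableSet_posDefVech, Set.inter_self]

/-! ### The deterministic bound. -/

theorem abs_exp_mul_one_add_sub_one_le {r s δ : ℝ} (hδ : δ ≤ 1 / 4) (hr : |r| ≤ δ / 4)
    (hs : |s| ≤ δ / 4) : |Real.exp r * (1 + s) - 1| ≤ δ := by
  have h1 : |Real.exp r - 1| ≤ 2 * |r| := Real.abs_exp_sub_one_le (by linarith)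
  have e : Real.exp r * (1 + s) - 1 = (Real.exp r - 1) + (Real.exp r - 1) * s + s := by ring
  rw [e]
  refine (abs_add_three _ _ _).trans ?_
  rw [abs_mul]
  nlinarith [abs_nonneg r, abs_nonneg s, abs_nonneg (Real.exp r - 1),
    mul_le_mul (h1.trans (by linarith : 2 * |r| ≤ 1)) hs (abs_nonneg s) zero_le_one]

/-- Non-asymptotic Bernstein–von Mises bound, on the event that the prior is flat around `S` and
both the posterior and the Gaussian limit concentrate in a spectral ball around `S`. -/
theorem l1Dist_le {p n : ℕ} (hn : 0 < n) {S Sig0 : Matrix (Fin p) (Fin p) ℝ} (hS : S.PosDef)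
    {f : Matrix (Fin p) (Fin p) ℝ → ℝ} (hf : IsPriorDensity f) {κ r δ : ℝ} (hκ : 0 < κ)
    (hSκ : ∀ v, κ * (v ⬝ᵥ v) ≤ v ⬝ᵥ S *ᵥ v) (hr0 : 0 < r) (hr : r / κ ≤ 1 / 2) (hδ : 0 < δ)
    (hδ' : δ ≤ 1 / 4) (hrem : 2 * n * p * (r / κ) ^ 3 ≤ δ / 4)
    (hflat : flatness f n S r < ENNReal.ofReal (δ / 4))
    (hpost : posterior f n S {x | r / 2 < specNorm (unvech x - Sig0)} ≤ ENNReal.ofReal δ)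
    (hS0 : specNorm (S - Sig0) ≤ r / 2)
    (htail : ∫⁻ x in {x : VechIdx p → ℝ | Real.sqrt n * r ≤ specNorm (unvech x)},
      ENNReal.ofReal (phi S (unvech x)) ≤ ENNReal.ofReal δ) :
    l1Dist f n S ≤ ENNReal.ofReal (8 * δ) := by
  have hSs := isSymm_of_posDef hS
  have hn0 : (0 : ℝ) < n := by exact_mod_cast hn
  have hsn : 0 < Real.sqrt n := Real.sqrt_pos.2 hn0
  have hrκ : r < κ := by
    rw [div_le_iff₀ hκ] at hr; linarith
  have hmemB : ∀ T : Matrix (Fin p) (Fin p) ℝ, T.IsSymm → specNorm T ≤ Real.sqrt n * r →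
      T ∈ setB n S := fun T hT hTr => by
    refine posDef_add_smul hS hT hSκ (lt_of_le_of_lt ?_ hrκ)
    rw [abs_of_pos (by positivity), div_mul_eq_mul_div, one_mul, div_le_iff₀ hsn]
    linarith
  have hflat' : ∀ T : Matrix (Fin p) (Fin p) ℝ, T.IsSymm → specNorm T ≤ Real.sqrt n * r →
      |f (S + (1 / Real.sqrt n) • T) / f S - 1| ≤ δ / 4 := fun T hT hTr => by
    have h1 : ENNReal.ofReal |f (S + (1 / Real.sqrt n) • T) / f S - 1| ≤ flatness f n S r :=
      le_iSup₂ (f := fun (T : Matrix (Fin p) (Fin p) ℝ)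
        (_ : T ∈ {T | T ∈ setB n S ∧ specNorm T ≤ Real.sqrt n * r}) =>
          ENNReal.ofReal |f (S + (1 / Real.sqrt n) • T) / f S - 1|) T ⟨hmemB T hT hTr, hTr⟩
    exact (ENNReal.ofReal_le_ofReal_iff (by positivity)).1 (h1.trans hflat.le)
  -- If f(S) were 0, the ratio at T = 0 would be 0/0 = 0, and the flatness would be at least 1.
  have hfS : 0 < f S := by
    refine lt_of_le_of_ne (hf.nonneg S) fun h => ?_
    have h0 : specNorm (0 : Matrix (Fin p) (Fin p) ℝ) = 0 := by simp [specNorm]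
    have := hflat' 0 Matrix.isSymm_zero (by rw [h0]; positivity)
    rw [← h] at this
    norm_num at this
    linarith
  set Z := Real.sqrt ((2 * Real.pi) ^ Fintype.card (VechIdx p) * (smnCov S).det) with hZ
  have hZ0 : 0 < Z := by
    have := (smnCov_posDef hS).det_pos
    exact Real.sqrt_pos.2 (by positivity)
  set h : (VechIdx p → ℝ) → ℝ := fun x =>
    likRatio n S (unvech x) * f (S + (1 / Real.sqrt n) • unvech x) with hh
  have hlik0 : ∀ T, 0 ≤ likRatio n S T := fun T => by
    unfold likRatio; split_ifs
    · exact Real.exp_nonneg _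
    · exact le_rfl
  let G : Set (VechIdx p → ℝ) := {x | specNorm (unvech x) ≤ Real.sqrt n * r}
  have hG : MeasurableSet G :=
    measurableSet_le (continuous_specNorm.comp continuous_unvech).measurable measurable_const
  have hB := measurableSet_setBVech (n := n) hSs
  have hphi0 : ∀ x, 0 ≤ phi S (unvech x) := fun x => by
    rw [phi_unvech]; exact normalPdf_nonneg _ _ _
  -- The factor t is exp(likelihood remainder) times the prior ratio; both are close to 1 on the
  -- ball.
  have hprop : ∀ x ∈ G, ∃ t : ℝ, |t - 1| ≤ δ ∧ h x = t * (f S * Z * phi S (unvech x)) := by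
    intro x hx
    have hxB : unvech x ∈ setB n S := hmemB _ (unvech_isSymm x) hx
    have hlan := abs_logLik_sub_add_trace_le hS (unvech_isSymm x) hκ hSκ hn hx (by
      rw [mul_comm κ, mul_div_mul_left _ _ hsn.ne']; exact hr)
    rw [mul_comm κ, mul_div_mul_left _ _ hsn.ne'] at hlan
    have hfl := hflat' _ (unvech_isSymm x) hx
    set D := logLik n S (S + (1 / Real.sqrt n) • unvech x) - logLik n S S with hD
    set q := (S⁻¹ * unvech x * S⁻¹ * unvech x).trace with hq
    refine ⟨_, abs_exp_mul_one_add_sub_one_le hδ' (hlan.trans hrem) hfl, ?_⟩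
    rw [hh]
    simp only
    rw [likRatio, if_pos hxB, ← hD, phi_eq hS (unvech_isSymm x), ← hZ, ← hq]
    have e : Real.exp D = Real.exp (D + q / 4) * Real.exp (-q / 4) := by
      rw [← Real.exp_add]; congr 1; ring
    rw [e]
    field_simp
    ring
  have hEJ := fun {A : Set (VechIdx p → ℝ)} (hA : MeasurableSet A) =>
    setLIntegral_likRatio_mul hn hSs hf hA
  have htop := unnormPosterior_univ_ne_top n hS hf
  have hBint := hEJ measurableSet_posDefVech
  rw [← setBVech_eq_preimage hSs, unnormPosterior_posDefVech] at hBint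
  have hAm : MeasurableSet {x : VechIdx p → ℝ | r / 2 < specNorm (unvech x - Sig0)} :=
    measurableSet_lt measurable_const
      (continuous_specNorm.comp (continuous_unvech.sub continuous_const)).measurable
  have key := lintegral_abs_div_integral_sub_le (μ := volume) (h := h)
    (φ := fun x => phi S (unvech x)) (c := f S * Z) (δ := δ) hB hG
    (fun x hx => hmemB _ (unvech_isSymm x) hx) (measurable_likRatio_mul hSs hf)
    (by simp_rw [phi_unvech]; fun_prop) (fun x => mul_nonneg (hlik0 _) (hf.nonneg _)) hphi0
    (lintegral_phi hS) (by positivity) hδ hδ'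
    (fun x hx => by
      obtain ⟨t, ht, e⟩ := hprop x hx
      rw [e]
      refine mul_le_mul_of_nonneg_right ?_ (mul_nonneg (by positivity) (hphi0 x))
      linarith [(abs_le.1 ht).1])
    (fun x hx => by
      obtain ⟨t, ht, e⟩ := hprop x hx
      rw [e]
      refine mul_le_mul_of_nonneg_right ?_ (mul_nonneg (by positivity) (hphi0 x))
      linarith [(abs_le.1 ht).2])
    (by
      rw [hBint]
      exact ENNReal.mul_ne_top (ENNReal.mul_ne_top ENNReal.ofReal_ne_top ENNReal.ofReal_ne_top)
        htop)
    (by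
      -- Outside the ball ‖Σ - S‖ > r, so ‖Σ - Σ₀‖ > r/2 by the bound on ‖S - Σ₀‖.
      have hsub : setBVech n S \ G ⊆ (fun x => vech S + (1 / Real.sqrt n) • x) ⁻¹'
          {x : VechIdx p → ℝ | r / 2 < specNorm (unvech x - Sig0)} := by
        rintro x ⟨-, hx⟩
        have hx : Real.sqrt n * r < specNorm (unvech x) := not_le.1 hx
        simp only [Set.mem_preimage, Set.mem_ofPred_eq, unvech_add, unvech_smul, unvech_vech S hSs]
        have e : (1 / Real.sqrt n) • unvech x =
            (S + (1 / Real.sqrt n) • unvech x - Sig0) + (Sig0 - S) := by abel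
        have h1 := specNorm_add_le (S + (1 / Real.sqrt n) • unvech x - Sig0) (Sig0 - S)
        rw [← e, specNorm_smul, specNorm_sub_comm Sig0 S, abs_of_pos (by positivity),
          div_mul_eq_mul_div, one_mul] at h1
        have h2 : r < specNorm (unvech x) / Real.sqrt n := by
          rw [lt_div_iff₀ hsn]; linarith
        linarith
      refine (lintegral_mono_set hsub).trans ?_
      rw [hEJ hAm, hBint, mul_left_comm]
      gcongr
      -- If the total mass is zero, normalisation is meaningless but both sides vanish.
      by_cases hz : unnormPosterior f n S Set.univ = 0
      · rw [measure_mono_null (Set.subset_univ _) hz]; exact zero_le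
      · rw [posterior, Measure.smul_apply, smul_eq_mul, mul_comm, ← div_eq_mul_inv,
          ENNReal.div_le_iff hz htop] at hpost
        exact hpost)
    (by
      refine (lintegral_mono_set fun x hx => ?_).trans htail
      exact (not_le.1 (show ¬ specNorm (unvech x) ≤ Real.sqrt n * r from hx)).le)
  exact key

/-! ### From diverging radii to a constant one, and the conclusion. -/

/-- A family, antitone in its parameter, that vanishes along every divergent sequence of parameters
is uniformly small for a large constant parameter. -/
theorem exists_const_eventually_le {a : ℕ → ℝ → ℝ≥0∞} (ha : ∀ n, Antitone (a n))
    (h : ∀ M : ℕ → ℝ, Tendsto M atTop atTop → Tendsto (fun n => a n (M n)) atTop (𝓝 0))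
    {η : ℝ≥0∞} (hη : 0 < η) :
    ∃ M₀ : ℝ, ∀ M ≥ M₀, ∀ᶠ n in atTop, a n M ≤ η := by
  by_contra hcon
  have hfreq : ∀ k : ℕ, ∃ᶠ n in atTop, η < a n k := fun k hk => by
    refine hcon ⟨k, fun M hM => ?_⟩
    filter_upwards [hk] with n hn
    exact (ha n hM).trans (not_lt.1 hn)
  obtain ⟨φ, hφ, hlt⟩ := extraction_forall_of_frequently hfreq
  -- A generalised inverse of φ: it diverges and equals k at φ k, so the radii M n = N n are
  -- admissible, yet a (φ k) k > η for every k.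
  let N : ℕ → ℕ := fun n => Nat.findGreatest (fun k => φ k ≤ n) n
  have hNφ : ∀ k, N (φ k) = k := fun k => by
    refine le_antisymm ?_ (Nat.le_findGreatest (hφ.id_le k) le_rfl)
    have : φ (N (φ k)) ≤ φ k :=
      Nat.findGreatest_spec (P := fun j => φ j ≤ φ k) (hφ.id_le k) le_rfl
    exact hφ.le_iff_le.1 this
  have hN : Tendsto N atTop atTop := tendsto_atTop.2 fun K => by
    filter_upwards [eventually_ge_atTop (φ K)] with n hn
    exact Nat.le_findGreatest ((hφ.id_le K).trans hn) hn
  have h1 := (h (fun n => N n) (tendsto_natCast_atTop_atTop.comp hN)).comp hφ.tendsto_atTop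
  obtain ⟨k, hk⟩ := (h1.eventually (gt_mem_nhds hη)).exists
  simp only [Function.comp_apply, hNφ] at hk
  exact absurd hk (not_lt.2 (hlt k).le)

end BvM

theorem theorem1
    {Ω : ℕ → Type*} [∀ n, MeasurableSpace (Ω n)]
    (P : ∀ n, Measure (Ω n)) [∀ n, IsProbabilityMeasure (P n)]
    (p : ℕ → ℕ) (hp : ∀ n, 1 ≤ p n)
    (Y : ∀ n, Fin n → Ω n → Fin (p n) → ℝ)
    (Sig0 : ∀ n, Matrix (Fin (p n)) (Fin (p n)) ℝ)
    (prior : ∀ n, Matrix (Fin (p n)) (Fin (p n)) ℝ → ℝ)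
    (kσ σ₀ : ℝ) (hk0 : 0 < kσ) (hk1 : kσ ≤ 1) (hσ₀ : 0 < σ₀)
    (hcond : ∀ n, BvM.WellConditioned kσ (Sig0 n))
    (htrue : ∀ n, BvM.TrueModel (P n) (Y n) (Sig0 n) σ₀)
    (hgrowth : Tendsto (fun n : ℕ => (p n : ℝ) ^ 5 / (n : ℝ)) atTop (𝓝 0))
    (hprior : ∀ n, BvM.IsPriorDensity (prior n))
    (hcontr : BvM.ContractsAtRate P (fun n ω => BvM.sampleCov fun i => Y n i ω) prior Sig0
      fun n => Real.sqrt ((p n : ℝ) / (n : ℝ)))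
    (hflat : BvM.FlatAround P (fun n ω => BvM.sampleCov fun i => Y n i ω) prior
      fun n => Real.sqrt ((p n : ℝ) / (n : ℝ))) :
    BvM.TendstoZeroInProb P fun n ω =>
      BvM.l1Dist (prior n) n (BvM.sampleCov fun i => Y n i ω) := by
  open BvM in
  intro ε hε
  refine ENNReal.tendsto_nhds_zero.2 fun η hη => ?_
  obtain ⟨δ, hδ, hδ4, hδε⟩ : ∃ δ : ℝ, 0 < δ ∧ δ ≤ 1 / 4 ∧ ENNReal.ofReal (8 * δ) < ε := by
    obtain ⟨d, hd0, hd⟩ := ENNReal.lt_iff_exists_nnreal_btwn.1 hε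
    have hd0' : (0 : ℝ) < d := by exact_mod_cast hd0
    refine ⟨min (d / 8) (1 / 4), by positivity, min_le_right _ _, lt_of_le_of_lt ?_ hd⟩
    rw [← ENNReal.ofReal_coe_nnreal]
    refine ENNReal.ofReal_le_ofReal ?_
    linarith [min_le_left ((d : ℝ) / 8) (1 / 4)]
  have hη3 : 0 < η / 3 := ENNReal.div_pos hη.ne' (by simp)
  have hδ' : 0 < ENNReal.ofReal δ := ENNReal.ofReal_pos.2 hδ
  obtain ⟨M₁, hM₁0, hM₁⟩ := exists_forall_meas_specNorm_sampleCov_le hσ₀ hk0 hη3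
  -- On the good event ‖S - Σ₀‖ ≤ kσ/2, so the eigenvalues of S are at most 1/kσ + kσ/2 and at least
  -- kσ/2.
  obtain ⟨M₂, hM₂0, hM₂⟩ := exists_forall_phi_tail_le (K := 1 / kσ + kσ / 2) (by positivity) hδ'
  obtain ⟨M₃, hM₃⟩ := exists_const_eventually_le
    (a := fun n M => P n {ω | ENNReal.ofReal δ ≤
      posterior (prior n) n (sampleCov fun i => Y n i ω)
        {x | M * Real.sqrt ((p n : ℝ) / n) < specNorm (unvech x - Sig0 n)}})
    (fun n M M' hMM => measure_mono fun ω hω => by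
      refine le_trans (show ENNReal.ofReal δ ≤ _ from hω) (measure_mono fun x hx => ?_)
      have hx : M' * Real.sqrt ((p n : ℝ) / n) < specNorm (unvech x - Sig0 n) := hx
      exact (mul_le_mul_of_nonneg_right hMM (Real.sqrt_nonneg _)).trans_lt hx)
    (fun M hM => hcontr M hM _ hδ') hη3
  -- Half of the radius is spent on ‖S - Σ₀‖ and half on the posterior around Σ₀; the Gaussian tail
  -- uses the whole.
  set M := max (2 * M₁) (max M₂ (2 * M₃)) with hM
  have hMM₁ : M₁ ≤ M / 2 := by linarith [le_max_left (2 * M₁) (max M₂ (2 * M₃))]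
  have hMM₂ : M₂ ≤ M := (le_max_left _ _).trans (le_max_right _ _)
  have hMM₃ : M₃ ≤ M / 2 := by
    linarith [(le_max_right M₂ (2 * M₃)).trans (le_max_right (2 * M₁) (max M₂ (2 * M₃)))]
  have hM0 : 0 < M := hM₂0.trans_le hMM₂
  have hsqrt : Tendsto (fun n : ℕ => Real.sqrt ((p n : ℝ) ^ 5 / n)) atTop (𝓝 0) := by
    simpa using hgrowth.sqrt
  have hsmall := hsqrt.const_mul (M / (kσ / 2))
  have hsmall' := hsqrt.const_mul (2 * (M / (kσ / 2)) ^ 3)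
  rw [mul_zero] at hsmall hsmall'
  have hflat' := ENNReal.tendsto_nhds_zero.1
    (hflat M hM0 (ENNReal.ofReal (δ / 4)) (ENNReal.ofReal_pos.2 (by positivity))) (η / 3) hη3
  filter_upwards [hM₃ (M / 2) hMM₃, hflat', hgrowth.eventually (gt_mem_nhds one_pos),
    hsmall.eventually (gt_mem_nhds (show (0 : ℝ) < 1 / 2 by norm_num)),
    hsmall'.eventually (gt_mem_nhds (show (0 : ℝ) < δ / 4 by positivity)),
    eventually_gt_atTop 0] with n hc hf h1 h2 h3 hn
  have hn0 : (0 : ℝ) < n := by exact_mod_cast hn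
  have hp1 : (1 : ℝ) ≤ p n := by exact_mod_cast hp n
  have hp0 : (0 : ℝ) < p n := by linarith
  have hp5 : (p n : ℝ) ≤ (p n : ℝ) ^ 5 := le_self_pow₀ hp1 (by norm_num)
  have hpn : p n ≤ n := by
    rw [div_lt_one hn0] at h1
    exact_mod_cast (hp5.trans h1.le)
  set ρ := Real.sqrt ((p n : ℝ) / n) with hρ
  set s := Real.sqrt ((p n : ℝ) ^ 5 / n) with hs
  have hρ0 : 0 < ρ := Real.sqrt_pos.2 (by positivity)
  have hρ2 : ρ ^ 2 = p n / n := Real.sq_sqrt (by positivity)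
  have hρs : ρ ≤ s := Real.sqrt_le_sqrt (by gcongr)
  -- Here the fifth power arises: n p (p/n)^{3/2} = √(p⁵/n).
  have hs3 : n * p n * ρ ^ 3 = s := by
    rw [hs, eq_comm, Real.sqrt_eq_iff_mul_self_eq (by positivity) (by positivity)]
    have : n * p n * ρ ^ 3 * (n * p n * ρ ^ 3) = n ^ 2 * (p n : ℝ) ^ 2 * (ρ ^ 2) ^ 3 := by ring
    rw [this, hρ2]; field_simp
  have hκ : 0 < kσ / 2 := by positivity
  have hrκ : M * ρ / (kσ / 2) ≤ 1 / 2 := by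
    calc M * ρ / (kσ / 2) = M / (kσ / 2) * ρ := by ring
      _ ≤ M / (kσ / 2) * s := by gcongr
      _ ≤ 1 / 2 := h2.le
  have hrk : M * ρ / 2 ≤ kσ / 2 := by
    rw [div_le_iff₀ hκ] at hrκ; nlinarith
  have hrem : 2 * n * p n * (M * ρ / (kσ / 2)) ^ 3 ≤ δ / 4 := by
    calc _ = 2 * (M / (kσ / 2)) ^ 3 * (n * p n * ρ ^ 3) := by ring
      _ = 2 * (M / (kσ / 2)) ^ 3 * s := by rw [hs3]
      _ ≤ _ := h3.le
  have hnr : Real.sqrt n * (M * ρ) = M * Real.sqrt (p n) := by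
    have : Real.sqrt n * ρ = Real.sqrt (p n) := by
      rw [hρ, ← Real.sqrt_mul hn0.le]; congr 1; field_simp
    rw [← this]; ring
  have hA := hM₁ (M / 2) hMM₁ (P n) (Y n) (Sig0 n) (hcond n) (htrue n) (hp n) hpn
  set E₁ := {ω | M / 2 * ρ ≤ specNorm (sampleCov (fun i => Y n i ω) - Sig0 n)} with hE₁
  set E₂ := {ω | ENNReal.ofReal δ ≤ posterior (prior n) n (sampleCov fun i => Y n i ω)
        {x | M / 2 * ρ < specNorm (unvech x - Sig0 n)}} with hE₂
  set E₃ := {ω | ENNReal.ofReal (δ / 4) ≤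
    flatness (prior n) n (sampleCov fun i => Y n i ω) (M * ρ)} with hE₃
  have hsub : {ω | ε ≤ l1Dist (prior n) n (sampleCov fun i => Y n i ω)} ⊆ E₁ ∪ E₂ ∪ E₃ := by
    intro ω hω
    by_contra hnot
    simp only [Set.mem_union, not_or] at hnot
    obtain ⟨⟨hn1, hn2⟩, hn3⟩ := hnot
    have hn1 : specNorm (sampleCov (fun i => Y n i ω) - Sig0 n) < M / 2 * ρ := not_le.1 hn1
    have hn2 : posterior (prior n) n (sampleCov fun i => Y n i ω)
        {x | M / 2 * ρ < specNorm (unvech x - Sig0 n)} < ENNReal.ofReal δ := not_le.1 hn2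
    have hn3 : flatness (prior n) n (sampleCov fun i => Y n i ω) (M * ρ) <
      ENNReal.ofReal (δ / 4) := not_le.1 hn3
    have hω : ε ≤ l1Dist (prior n) n (sampleCov fun i => Y n i ω) := hω
    set S := sampleCov fun i => Y n i ω with hS
    have hdiff : specNorm (S - Sig0 n) ≤ kσ / 2 := by linarith
    have hquad : ∀ v, |v ⬝ᵥ (S - Sig0 n) *ᵥ v| ≤ kσ / 2 * (v ⬝ᵥ v) := fun v => by
      refine (abs_dotProduct_mulVec_le _ v).trans (mul_le_mul_of_nonneg_right hdiff ?_)
      rw [dotProduct]; exact Finset.sum_nonneg fun i _ => mul_self_nonneg _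
    have hSpd : S.PosDef := by
      have hsym : (S - Sig0 n).IsSymm :=
        (sampleCov_isSymm _).sub (isSymm_of_posDef ((hcond n).posDef hk0))
      have := posDef_add_smul ((hcond n).posDef hk0) hsym (c := 1)
        (fun v => ((hcond n).dotProduct_bounds v).1) (by rw [abs_one, one_mul]; linarith)
      rwa [one_smul, add_sub_cancel] at this
    have hlow : ∀ v, kσ / 2 * (v ⬝ᵥ v) ≤ v ⬝ᵥ S *ᵥ v := fun v => by
      have h4 := (abs_le.1 (hquad v)).1
      rw [Matrix.sub_mulVec, dotProduct_sub] at h4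
      linarith [((hcond n).dotProduct_bounds v).1]
    have hupp : ∀ v, v ⬝ᵥ S *ᵥ v ≤ (1 / kσ + kσ / 2) * (v ⬝ᵥ v) := fun v => by
      have h4 := (abs_le.1 (hquad v)).2
      rw [Matrix.sub_mulVec, dotProduct_sub] at h4
      linarith [((hcond n).dotProduct_bounds v).2]
    have hr2 : M * ρ / 2 = M / 2 * ρ := by ring
    have := l1Dist_le hn hSpd (hprior n) hκ hlow (by positivity) hrκ hδ hδ4 hrem hn3
      (by rw [hr2]; exact hn2.le) (by rw [hr2]; exact hn1.le)
      (by rw [hnr]; exact hM₂ M hMM₂ S (hp n) hSpd hupp)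
    exact absurd (hω.trans this) (not_le.2 hδε)
  calc P n {ω | ε ≤ l1Dist (prior n) n (sampleCov fun i => Y n i ω)}
      ≤ P n (E₁ ∪ E₂ ∪ E₃) := measure_mono hsub
    _ ≤ P n E₁ + P n E₂ + P n E₃ :=
        (measure_union_le _ _).trans (by gcongr; exact measure_union_le _ _)
    _ ≤ η / 3 + η / 3 + η / 3 := by gcongr
    _ = η := ENNReal.add_thirds η
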